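/- Let $p,q\ge 1$ be coprime integers with $p$ even, $T=2\pi p/q$ and $\Omega=(0,T)\times(0,\pi)$. Let $u\in C^2[0,\pi]$ with $u>0$ on $[0,\pi]$, and let $f(t,x,y)$ be real-valued, continuous on $\Omega\times\mathbb R$ and $T$-periodic in $t$; put $\hat f=f/u$. Let $L^2(\Omega)$ be the space of real functions on $\Omega$ (identified when equal a.e., and extended $T$-periodically in $t$) with inner product $\langle y,z\rangle=\int_\Omega u\,y\,z\,dt\,dx$. Assume that for every $R>0$ there is $h_R\in L^2(\Omega)$ with $|\hat f(t,x,y)|\le h_R(t,x)$ for a.e. $(t,x)\in\Omega$ and all $|y|\le R$. Consider the problem $$u(x)y_{tt}-(u(x)y_x)_x=f(t,x,y)\ \text{ in }\Omega,\qquad y(0,x)=y(T,x),\quad y_t(0,x)=y_t(T,x),\qquad y(t,0)=y(t,\pi)=0 .\tag{P}$$ A (weak) solution of (P) is a function $y\in L^2(\Omega)$ with $$\int_\Omega y\,\bigl(u\psi_{tt}-(u\psi_x)_x\bigr)\,dt\,dx-\int_\Omega f(t,x,y)\,\psi\,dt\,dx=0$$ for all $\psi\in C^\infty(\overline\Omega)$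 such that $\psi(t,0)=\psi(t,\pi)=0$, $\psi(0,x)=\psi(T,x)$ and $\psi_t(0,x)=\psi_t(T,x)$. Let $\lambda_n^2$ and $\varphi_n$ $(n\ge1)$ be the eigenvalues and eigenfunctions of $(u\varphi')'=-\lambda^2u\varphi$ on $(0,\pi)$, $\varphi(0)=\varphi(\pi)=0$. Let $L$ be the operator in $L^2(\Omega)$ that multiplies the Fourier coefficients of $y$ with respect to $\varphi_n(x)\cos\frac{2\pi m t}{T}$ and $\varphi_n(x)\sin\frac{2\pi m t}{T}$ $(m\ge0)$ by $\lambda_n^2-(2\pi m/T)^2$, with domain $D(L)$ the set of those $y\in L^2(\Omega)$ for which the result lies in $L^2(\Omega)$. Put $$M_o=\{y\in L^2(\Omega): y(t+T/2,x)=-y(t,x)\},\qquad M_e=\{y\in L^2(\Omega): y(t+T/2,x)=y(t,x)\},$$ let $L_o$ be the restriction of $L$ to $M_o\cap D(L)$, and let $\Lambda(L_o)$ be the set of eigenvalues of $L_o$. Let $\underline\lambda<\bar\lambda$ be two consecutive elements of $\Lambda(L_o)$, and let $\alpha,\beta\in M_e\cap L^\infty(\Omega)$ satisfy $\underline\lambda\le\alpha\le\beta\le\bar\lambda$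 a.e. in $\Omega$, $$\int_\Omega(\alpha-\underline\lambda)v^2\,dt\,dx>0\quad\text{for all } v\in\ker(L_o-\underline\lambda I)\setminus\{0\},$$ $$\int_\Omega(\bar\lambda-\beta)w^2\,dt\,dx>0\quad\text{for all } w\in\ker(L_o-\bar\lambda I)\setminus\{0\}.$$ Suppose that $\hat f(t+T/2,x,y)=\hat f(t,x,y)$ and $\hat f(t,x,-y)=-\hat f(t,x,y)$ for all $t,y\in\mathbb R$ and $x\in(0,\pi)$, and that for a.e. $(t,x)\in\Omega$ $$\alpha(t,x)\le\frac{\hat f(t,x,y)-\hat f(t,x,z)}{y-z}\le\beta(t,x)\qquad\text{for all real } y\ne z .$$ Then $y=0$ is a weak solution of (P) in $M_o$, and it is the only one. -/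

import Mathlib

open MeasureTheory Set
open scoped ContDiff

namespace VarWave

noncomputable section

/-- The space-time domain `Ω = (0, T) × (0, π)`; its points are `z = (t, x)`. -/
def domain (T : ℝ) : Set (ℝ × ℝ) := Ioo 0 T ×ˢ Ioo 0 Real.pi

/-- The left half `(0, T/2) × (0, π)` of `Ω`. -/
def halfDomain (T : ℝ) : Set (ℝ × ℝ) := Ioo 0 (T / 2) ×ˢ Ioo 0 Real.pi

/-- Lebesgue measure `dt dx` on `Ω`. -/
def dom (T : ℝ) : Measure (ℝ × ℝ) := volume.restrict (domain T)

/-- `y ∈ L²(Ω)`, the weighted space of measurable real functions on `Ω` with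
`∫_Ω u(x) |y(t,x)|² dt dx < ∞`.  Its elements are represented by functions; equality in `L²(Ω)`
is equality `dom T`-almost everywhere. -/
def MemL2 (u : ℝ → ℝ) (T : ℝ) (y : ℝ × ℝ → ℝ) : Prop :=
  AEStronglyMeasurable y (dom T) ∧ Integrable (fun z => u z.2 * |y z| ^ 2) (dom T)

/-- `y(t + T/2, x) = - y(t, x)` a.e., for the `T`-periodic extension of a function `y` on `Ω`.
For that extension it is enough to ask this for `t ∈ (0, T/2)`. -/
def HalfAntiperiodic (T : ℝ) (y : ℝ × ℝ → ℝ) : Prop :=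
  ∀ᵐ z ∂(volume.restrict (halfDomain T)), y (z.1 + T / 2, z.2) = - y z

/-- `y(t + T/2, x) = y(t, x)` a.e., for the `T`-periodic extension of a function `y` on `Ω`. -/
def HalfPeriodic (T : ℝ) (y : ℝ × ℝ → ℝ) : Prop :=
  ∀ᵐ z ∂(volume.restrict (halfDomain T)), y (z.1 + T / 2, z.2) = y z

/-- The subspace `M_o` of `L²(Ω)`. -/
def MemMo (u : ℝ → ℝ) (T : ℝ) (y : ℝ × ℝ → ℝ) : Prop :=
  MemL2 u T y ∧ HalfAntiperiodic T y

/-- The subspace `M_e` of `L²(Ω)`. -/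
def MemMe (u : ℝ → ℝ) (T : ℝ) (y : ℝ × ℝ → ℝ) : Prop :=
  MemL2 u T y ∧ HalfPeriodic T y

/-- `φ` is an eigenfunction, with eigenvalue `ν` (`= λ_n²`), of the Sturm-Liouville problem
`(u φ')' = - ν u φ` on `(0, π)`, `φ(0) = φ(π) = 0`. -/
structure IsDirichletEigenpair (u : ℝ → ℝ) (ν : ℝ) (φ : ℝ → ℝ) : Prop where
  contDiffOn : ContDiffOn ℝ 2 φ (Icc 0 Real.pi)
  left : φ 0 = 0
  right : φ Real.pi = 0
  eqn : ∀ x ∈ Ioo 0 Real.pi, deriv (fun s => u s * deriv φ s) x = - ν * u x * φ x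
  ne_zero : ∃ x ∈ Icc 0 Real.pi, φ x ≠ 0

/-- The `L²(Ω)` inner product of `y` with `φ(x) cos(2πmt/T)`. -/
def cosCoeff (u : ℝ → ℝ) (T : ℝ) (φ : ℝ → ℝ) (m : ℕ) (y : ℝ × ℝ → ℝ) : ℝ :=
  ∫ z, u z.2 * y z * (φ z.2 * Real.cos (2 * Real.pi / T * m * z.1)) ∂(dom T)

/-- The `L²(Ω)` inner product of `y` with `φ(x) sin(2πmt/T)`. -/
def sinCoeff (u : ℝ → ℝ) (T : ℝ) (φ : ℝ → ℝ) (m : ℕ) (y : ℝ × ℝ → ℝ) : ℝ :=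
  ∫ z, u z.2 * y z * (φ z.2 * Real.sin (2 * Real.pi / T * m * z.1)) ∂(dom T)

/-- The graph of the wave operator `L`: `y ∈ D(L)` and `L y = g`.  The function `g ∈ L²(Ω)` is the
one whose Fourier coefficients along the complete orthogonal system
`φ_n(x) cos(2πmt/T), φ_n(x) sin(2πmt/T)` are those of `y` multiplied by
`μ_{mn} = λ_n² - (2πm/T)²`.  Such a `g` in `L²(Ω)` exists exactly when the squares of the
multiplied coefficients of `y` are summable, that is when `y ∈ D(L)`.  (The relation between the
coefficients is homogeneous in `φ_n`, so that the eigenfunctions need not be normalized.) -/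
def WaveOp (u : ℝ → ℝ) (T : ℝ) (y g : ℝ × ℝ → ℝ) : Prop :=
  MemL2 u T y ∧ MemL2 u T g ∧
    ∀ (ν : ℝ) (φ : ℝ → ℝ), IsDirichletEigenpair u ν φ → ∀ m : ℕ,
      cosCoeff u T φ m g = (ν - (2 * Real.pi / T * m) ^ 2) * cosCoeff u T φ m y ∧
      sinCoeff u T φ m g = (ν - (2 * Real.pi / T * m) ^ 2) * sinCoeff u T φ m y

/-- `v ∈ ker (L_o - lam I)`, where `L_o` is the restriction of `L` to `M_o ∩ D(L)`. -/
def MemKerLo (u : ℝ → ℝ) (T lam : ℝ) (v : ℝ × ℝ → ℝ) : Prop :=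
  MemMo u T v ∧ WaveOp u T v (fun z => lam * v z)

/-- The set `Λ(L_o)` of the eigenvalues of `L_o`. -/
def eigenvaluesLo (u : ℝ → ℝ) (T : ℝ) : Set ℝ :=
  {lam | ∃ v, MemKerLo u T lam v ∧ ¬ v =ᵐ[dom T] 0}

/-- `a < b` are consecutive elements of `S`. -/
def Consecutive (S : Set ℝ) (a b : ℝ) : Prop :=
  a ∈ S ∧ b ∈ S ∧ a < b ∧ ∀ c ∈ S, ¬ (a < c ∧ c < b)

/-- The class `Ψ` of test functions: smooth up to the boundary of `Ω`, zero at `x = 0` and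
`x = π`, and with `ψ` and `ψ_t` taking the same values at `t = 0` and `t = T`. -/
structure IsTestFunction (T : ℝ) (ψ : ℝ × ℝ → ℝ) : Prop where
  smooth : ContDiff ℝ ∞ ψ
  left : ∀ t ∈ Ioo 0 T, ψ (t, 0) = 0
  right : ∀ t ∈ Ioo 0 T, ψ (t, Real.pi) = 0
  periodic : ∀ x ∈ Ioo 0 Real.pi, ψ (0, x) = ψ (T, x)
  periodic_deriv : ∀ x ∈ Ioo 0 Real.pi,
    deriv (fun s => ψ (s, x)) 0 = deriv (fun s => ψ (s, x)) T

/-- `(u ψ_tt - (u ψ_x)_x)(t, x)` for a smooth function `ψ`. -/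
def waveExpr (u : ℝ → ℝ) (ψ : ℝ × ℝ → ℝ) (z : ℝ × ℝ) : ℝ :=
  u z.2 * deriv (fun s => deriv (fun r => ψ (r, z.2)) s) z.1
    - deriv (fun s => u s * deriv (fun r => ψ (z.1, r)) s) z.2

/-- `y ∈ L²(Ω)` is a weak solution of `u y_tt - (u y_x)_x = f(t, x, y)` with the time-periodic and
Dirichlet conditions:
`∫_Ω y (u ψ_tt - (u ψ_x)_x) dt dx - ∫_Ω f(t,x,y) ψ dt dx = 0` for all `ψ ∈ Ψ`, where the second
integral is required to converge (the first one always does when `u` is `C²` on `[0, π]`). -/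
def IsWeakSolution (u : ℝ → ℝ) (T : ℝ) (f : ℝ → ℝ → ℝ → ℝ) (y : ℝ × ℝ → ℝ) : Prop :=
  MemL2 u T y ∧ ∀ ψ, IsTestFunction T ψ →
    Integrable (fun z => f z.1 z.2 (y z) * ψ z) (dom T) ∧
    (∫ z, y z * waveExpr u ψ z ∂(dom T)) - (∫ z, f z.1 z.2 (y z) * ψ z ∂(dom T)) = 0

/-- The quotient `f / u`. -/
def fhat (u : ℝ → ℝ) (f : ℝ → ℝ → ℝ → ℝ) (t x y : ℝ) : ℝ := f t x y / u x

end

end VarWave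

namespace VarWave

open Filter Topology

/-! Oddness gives `fhat = 0` at `y = 0`, so the zero function is a solution. For uniqueness, let `y`
be a weak solution in `M_o` and put `g = fhat(t, x, y)`. Comparing `y` with `0` in the slope
condition gives `g = a y` with `α ≤ a ≤ β` pointwise, so `g` is in `L²` and the nonlinear problem
becomes the linear equation `L y = a y`.

Membership in `M_o` means that `y` has only odd time frequencies (`halfAntiperiodic_iff`), so the
spectrum seen by `y` consists of eigenvalues of `L_o`, none strictly between `lam₁` and `lam₂`.
Write `y = v + w`, with `v` carried by eigenvalues at most `lam₁` and `w` by those at least `lam₂`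
(`exists_split_of_gap`). Pairing `a y` with `v - w` makes the cross terms cancel, and therefore ∫ (a
- lam₁) v² + (lam₂ - a) w² = (⟨Ly, v⟩ - lam₁ ‖v‖²) + (lam₂ ‖w‖² - ⟨Ly, w⟩) ≤ 0, after the
substitution by `√u` that removes the weight. The left side dominates the integral of (α - lam₁) v²
+ (lam₂ - β) w², which is nonnegative, so everything vanishes. Equality in the spectral inequalities
puts `v` and `w` in the two kernels, and the strict integral conditions force both to be zero. This
is `ae_eq_zero_of_nonresonance`.

Two analytic facts support this argument. The modes `φ_n(x) cos`, `φ_n(x) sin` are complete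
(`ae_eq_zero_of_modeCoeff_eq_zero`): the Dirichlet eigenfunctions come from the spectral theorem for
a compact injective Green operator, and the time factor from Parseval. A weak solution satisfies the
coefficient relations defining `L` (`modeCoeff_of_weak`), although the modes need not be smooth
enough to serve as test functions. Simplicity of the Dirichlet eigenvalues is never needed: modes
are grouped by the label `(ν, m)`, and a Hilbert basis is chosen inside the closed span of each
label (`exists_hilbertBasis_of_labelled`). -/

/-- The Hilbert space `L²(0, b)`. -/
noncomputable abbrev L2I (b : ℝ) := Lp ℝ 2 (volume.restrict (Ioc 0 b))

/-! ### Compactness and adjoint of the integration operator on `L²(0, b)`. -/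

section Volterra

variable {b : ℝ}

lemma integrable_L2I (h : L2I b) : Integrable h (volume.restrict (Ioc 0 b)) :=
  (Lp.memLp h).integrable (by norm_num)

lemma intervalIntegrable_L2I (h : L2I b) {s t : ℝ} (hs : s ∈ Icc 0 b) (ht : t ∈ Icc 0 b) :
    IntervalIntegrable h volume s t := by
  have h1 : IntegrableOn h (Ioc 0 b) := (integrable_L2I h)
  refine ⟨h1.mono_set ?_, h1.mono_set ?_⟩
  · exact Ioc_subset_Ioc hs.1 ht.2
  · exact Ioc_subset_Ioc ht.1 hs.2

/-- Cauchy–Schwarz against the indicator of `(s, t]`. The resulting Hölder-1/2 modulus gives both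
the boundedness and the equicontinuity of primitives. -/
lemma abs_intervalIntegral_le_sqrt (h : L2I b) {s t : ℝ} (hs : 0 ≤ s) (hst : s ≤ t) (ht : t ≤ b) :
    |∫ x in s..t, h x| ≤ √(t - s) * ‖h‖ := by
  have hm : (volume.restrict (Ioc 0 b)) (Ioc s t) ≠ ⊤ := measure_ne_top _ _
  have h1 := L2.inner_indicatorConstLp_one (𝕜 := ℝ) measurableSet_Ioc hm h
  have hsub : Ioc s t ∩ Ioc 0 b = Ioc s t :=
    inter_eq_left.2 (Ioc_subset_Ioc hs ht)
  rw [Measure.restrict_restrict measurableSet_Ioc, hsub] at h1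
  rw [intervalIntegral.integral_of_le hst, ← h1]
  refine (abs_real_inner_le_norm _ _).trans ?_
  rw [norm_indicatorConstLp (by norm_num) (by norm_num)]
  gcongr
  rw [measureReal_restrict_apply measurableSet_Ioc, hsub, Real.volume_real_Ioc_of_le hst,
    Real.sqrt_eq_rpow]
  simp

lemma abs_intervalIntegral_le_sqrt_abs (h : L2I b) {s t : ℝ} (hs : s ∈ Icc 0 b)
    (ht : t ∈ Icc 0 b) : |∫ x in s..t, h x| ≤ √|t - s| * ‖h‖ := by
  rcases le_total s t with hst | hst
  · rw [abs_of_nonneg (sub_nonneg.2 hst)]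
    exact abs_intervalIntegral_le_sqrt h hs.1 hst ht.2
  · rw [abs_of_nonpos (sub_nonpos.2 hst), neg_sub, intervalIntegral.integral_symm, abs_neg]
    exact abs_intervalIntegral_le_sqrt h ht.1 hst hs.2

lemma abs_primitive_sub_le (h : L2I b) {s t : ℝ} (hs : s ∈ Icc 0 b) (ht : t ∈ Icc 0 b) :
    |(∫ x in 0..t, h x) - ∫ x in 0..s, h x| ≤ √|t - s| * ‖h‖ := by
  have h0 : (0 : ℝ) ∈ Icc 0 b := ⟨le_rfl, hs.1.trans hs.2⟩
  rw [intervalIntegral.integral_interval_sub_left (intervalIntegrable_L2I h h0 ht)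
    (intervalIntegrable_L2I h h0 hs)]
  exact abs_intervalIntegral_le_sqrt_abs h hs ht

lemma continuousOn_primitive_L2I (h : L2I b) :
    ContinuousOn (fun t => ∫ x in 0..t, h x) (Icc 0 b) := by
  rcases lt_or_ge b 0 with hb | hb
  · simp [Icc_eq_empty_of_lt hb]
  have := intervalIntegral.continuousOn_primitive_interval (f := h) (μ := volume) (a := 0) (b := b)
    (by rw [uIcc_of_le hb, integrableOn_Icc_iff_integrableOn_Ioc]; exact (integrable_L2I h))
  rwa [uIcc_of_le hb] at this

/-- The primitive vanishing at `0` of an element of `L²(0, b)`, as a continuous function. -/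
noncomputable def primitiveC (h : L2I b) : C(Icc (0 : ℝ) b, ℝ) where
  toFun t := ∫ x in 0..(t : ℝ), h x
  continuous_toFun := (continuousOn_primitive_L2I h).domRestrict

lemma primitiveC_apply (h : L2I b) (t : Icc (0 : ℝ) b) :
    primitiveC h t = ∫ x in 0..(t : ℝ), h x := rfl

/-- The primitive vanishing at `0`, as an operator from `L²(0, b)` to `C[0, b]`. -/
noncomputable def primitiveL (hb : 0 ≤ b) : L2I b →L[ℝ] C(Icc (0 : ℝ) b, ℝ) :=
  LinearMap.mkContinuous
    { toFun := primitiveC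
      map_add' := by
        intro g h
        ext t
        have h0 : (0 : ℝ) ∈ Icc 0 b := ⟨le_rfl, hb⟩
        rw [ContinuousMap.add_apply, primitiveC_apply, primitiveC_apply, primitiveC_apply,
          ← intervalIntegral.integral_add (intervalIntegrable_L2I g h0 t.2)
          (intervalIntegrable_L2I h h0 t.2)]
        rw [intervalIntegral.integral_of_le t.2.1, intervalIntegral.integral_of_le t.2.1]
        refine integral_congr_ae (ae_restrict_of_ae_restrict_of_subset
          (Ioc_subset_Ioc_right t.2.2) ?_)
        filter_upwards [Lp.coeFn_add g h] with x hx using hx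
      map_smul' := by
        intro c h
        ext t
        rw [RingHom.id_apply, ContinuousMap.smul_apply, smul_eq_mul, primitiveC_apply,
          primitiveC_apply, ← intervalIntegral.integral_const_mul,
          intervalIntegral.integral_of_le t.2.1, intervalIntegral.integral_of_le t.2.1]
        refine integral_congr_ae (ae_restrict_of_ae_restrict_of_subset
          (Ioc_subset_Ioc_right t.2.2) ?_)
        filter_upwards [Lp.coeFn_smul c h] with x hx using hx }
    (√b) (by
      intro h
      rw [ContinuousMap.norm_le _ (by positivity)]
      intro t
      refine (abs_intervalIntegral_le_sqrt h le_rfl t.2.1 t.2.2).trans ?_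
      rw [sub_zero]
      gcongr
      exact t.2.2)

lemma primitiveL_apply (hb : 0 ≤ b) (h : L2I b) (t : Icc (0 : ℝ) b) :
    primitiveL hb h t = ∫ x in 0..(t : ℝ), h x := rfl

/-- Arzelà–Ascoli: primitives of the unit ball of `L²` are bounded by `√b` and share the modulus of
continuity `√r`. -/
lemma isCompactOperator_primitiveL (hb : 0 ≤ b) : IsCompactOperator (primitiveL hb) := by
  refine (isCompactOperator_iff_isCompact_closure_image_closedBall
    (primitiveL hb : L2I b →ₗ[ℝ] C(Icc (0 : ℝ) b, ℝ)) one_pos).2 ?_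
  let e := (ContinuousMap.isometryEquivBoundedOfCompact (Icc (0 : ℝ) b) ℝ)
  set A : Set C(Icc (0 : ℝ) b, ℝ) := primitiveL hb '' Metric.closedBall 0 1 with hA
  have hcomp : IsCompact (closure (e '' A)) := by
    refine BoundedContinuousFunction.arzela_ascoli (Icc (-√b) (√b)) isCompact_Icc _ ?_ ?_
    · rintro _ x ⟨_, ⟨h, hh, rfl⟩, rfl⟩
      have h1 : ‖h‖ ≤ 1 := by simpa using hh
      have h2 := abs_intervalIntegral_le_sqrt h le_rfl x.2.1 x.2.2
      rw [sub_zero] at h2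
      refine mem_Icc.2 (abs_le.1 (h2.trans ?_))
      calc √(x : ℝ) * ‖h‖ ≤ √b * 1 := by gcongr; exact x.2.2
        _ = √b := mul_one _
    · refine Metric.equicontinuous_of_continuity_modulus (fun r => √|r|) ?_ _ ?_
      · have : Continuous fun r : ℝ => √|r| := by fun_prop
        simpa using this.tendsto 0
      · rintro x y ⟨_, ⟨_, ⟨h, hh, rfl⟩, rfl⟩⟩
        have h1 : ‖h‖ ≤ 1 := by simpa using hh
        have h2 := abs_primitive_sub_le h y.2 x.2
        rw [abs_of_nonneg dist_nonneg, Subtype.dist_eq, Real.dist_eq, Real.dist_eq]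
        exact h2.trans (by nlinarith [Real.sqrt_nonneg |(x : ℝ) - y|])
  have h3 : closure A = e.symm '' closure (e '' A) := by
    have := e.symm.toHomeomorph.image_closure (e '' A)
    simp only [IsometryEquiv.coe_toHomeomorph] at this
    rw [this, ← image_comp]
    simp
  change IsCompact (closure A)
  rw [h3]
  exact hcomp.image e.symm.continuous

lemma memLp_IccExtend (hb : 0 ≤ b) (f : C(Icc (0 : ℝ) b, ℝ)) :
    MemLp (IccExtend hb f) 2 (volume.restrict (Ioc 0 b)) :=
  MemLp.of_bound f.continuous.Icc_extend'.aestronglyMeasurable ‖f‖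
    (ae_of_all _ fun _ => f.norm_coe_le_norm _)

/-- The inclusion of `C[0, b]` into `L²(0, b)`. -/
noncomputable def contToL2I (hb : 0 ≤ b) : C(Icc (0 : ℝ) b, ℝ) →L[ℝ] L2I b :=
  LinearMap.mkContinuous
    { toFun := fun f => (memLp_IccExtend hb f).toLp
      map_add' := fun f g => by
        rw [← MemLp.toLp_add]
        rfl
      map_smul' := fun c f => by
        rw [RingHom.id_apply, ← MemLp.toLp_const_smul]
        rfl }
    (((volume.restrict (Ioc 0 b)) univ).toReal ^ (1 / 2 : ℝ)) (by
      intro f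
      simp only [LinearMap.coe_mk, AddHom.coe_mk, Lp.norm_toLp]
      refine ENNReal.toReal_le_of_le_ofReal (by positivity) ?_
      refine (eLpNorm_le_of_ae_bound (C := ‖f‖)
        (ae_of_all _ fun _ => f.norm_coe_le_norm _)).trans ?_
      rw [ENNReal.ofReal_mul (by positivity), ← ENNReal.ofReal_rpow_of_nonneg (by positivity)
        (by positivity), ENNReal.ofReal_toReal (by finiteness)]
      norm_num)

lemma contToL2I_ae (hb : 0 ≤ b) (f : C(Icc (0 : ℝ) b, ℝ)) :
    contToL2I hb f =ᵐ[volume.restrict (Ioc 0 b)] IccExtend hb f :=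
  (memLp_IccExtend hb f).coeFn_toLp

/-- The Volterra operator on `L²(0, b)`. -/
noncomputable def volterra (hb : 0 ≤ b) : L2I b →L[ℝ] L2I b := contToL2I hb ∘L primitiveL hb

lemma volterra_ae (hb : 0 ≤ b) (h : L2I b) :
    volterra hb h =ᵐ[volume.restrict (Ioc 0 b)] fun t => ∫ x in 0..t, h x := by
  filter_upwards [contToL2I_ae hb (primitiveL hb h), ae_restrict_mem measurableSet_Ioc]
    with t ht hmem
  rw [volterra, ContinuousLinearMap.comp_apply, ht,
    IccExtend_of_mem hb _ (Ioc_subset_Icc_self hmem), primitiveL_apply]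

lemma isCompactOperator_volterra (hb : 0 ≤ b) : IsCompactOperator (volterra hb) :=
  (isCompactOperator_primitiveL hb).clm_comp (contToL2I hb)

/-- Integration by parts for primitives of integrable functions. -/
lemma integral_mul_primitive {g h : ℝ → ℝ} (hg : IntegrableOn g (Ioc 0 b))
    (hh : IntegrableOn h (Ioc 0 b)) :
    ∫ x in Ioc 0 b, g x * ∫ s in 0..x, h s = ∫ s in Ioc 0 b, (∫ x in s..b, g x) * h s := by
  set I := volume.restrict (Ioc 0 b)
  have h1 : Integrable (fun z : ℝ × ℝ => g z.1 * h z.2) (I.prod I) := hg.mul_prod hh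
  -- Fubini on the triangle `s ≤ x`; the indicator turns both iterated integrals into integrals over
  -- the square.
  have h2 : Integrable (Function.uncurry fun x s => {z : ℝ × ℝ | z.2 ≤ z.1}.indicator
      (fun z : ℝ × ℝ => g z.1 * h z.2) (x, s)) (I.prod I) :=
    h1.indicator (measurableSet_le measurable_snd measurable_fst)
  have h3 := integral_integral_swap h2
  have e1 : ∀ x ∈ Ioc 0 b, ∫ s, {z : ℝ × ℝ | z.2 ≤ z.1}.indicator
      (fun z : ℝ × ℝ => g z.1 * h z.2) (x, s) ∂I = g x * ∫ s in 0..x, h s := by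
    intro x hx
    have : (fun s => {z : ℝ × ℝ | z.2 ≤ z.1}.indicator
        (fun z : ℝ × ℝ => g z.1 * h z.2) (x, s)) = (Iic x).indicator fun s => g x * h s := by
      ext s; simp [indicator]
    rw [this, integral_indicator measurableSet_Iic, integral_const_mul,
      Measure.restrict_restrict measurableSet_Iic, intervalIntegral.integral_of_le hx.1.le]
    congr 3
    ext s
    simp only [mem_inter_iff, mem_Iic, mem_Ioc]
    constructor
    · exact fun h => ⟨h.2.1, h.1⟩
    · exact fun h => ⟨h.2, h.1, h.2.trans hx.2⟩
  have e2 : ∀ s ∈ Ioc 0 b, ∫ x, {z : ℝ × ℝ | z.2 ≤ z.1}.indicator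
      (fun z : ℝ × ℝ => g z.1 * h z.2) (x, s) ∂I = (∫ x in s..b, g x) * h s := by
    intro s hs
    have : (fun x => {z : ℝ × ℝ | z.2 ≤ z.1}.indicator
        (fun z : ℝ × ℝ => g z.1 * h z.2) (x, s)) = (Ici s).indicator fun x => g x * h s := by
      ext x; simp [indicator]
    rw [this, integral_indicator measurableSet_Ici, integral_mul_const,
      Measure.restrict_restrict measurableSet_Ici, intervalIntegral.integral_of_le hs.2]
    congr 1
    rw [← integral_Icc_eq_integral_Ioc]
    congr 2
    ext x
    simp only [mem_inter_iff, mem_Ici, mem_Ioc, mem_Icc]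
    constructor
    · exact fun h => ⟨h.1, h.2.2⟩
    · exact fun h => ⟨h.1, hs.1.trans_le h.1, h.2⟩
  rw [setIntegral_congr_fun measurableSet_Ioc fun x hx => (e1 x hx).symm,
    setIntegral_congr_fun measurableSet_Ioc fun x hx => (e2 x hx).symm]
  exact h3

lemma memLp_continuousOn {f : ℝ → ℝ} (p : ENNReal) (hf : ContinuousOn f (Icc 0 b)) :
    MemLp f p (volume.restrict (Ioc 0 b)) := by
  obtain ⟨C, hC⟩ := isCompact_Icc.exists_bound_of_continuousOn hf
  exact MemLp.of_bound
    ((hf.mono Ioc_subset_Icc_self).aestronglyMeasurable measurableSet_Ioc) C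
    ((ae_restrict_mem measurableSet_Ioc).mono fun x hx => hC x (Ioc_subset_Icc_self hx))

lemma continuousOn_reverse_primitive (h : L2I b) :
    ContinuousOn (fun t => ∫ x in t..b, h x) (Icc 0 b) := by
  have : ContinuousOn (fun t => (∫ x in 0..b, h x) - ∫ x in 0..t, h x) (Icc 0 b) :=
    continuousOn_const.sub (continuousOn_primitive_L2I h)
  refine this.congr fun t ht => ?_
  have h0 : (0 : ℝ) ∈ Icc 0 b := ⟨le_rfl, ht.1.trans ht.2⟩
  have hb : b ∈ Icc 0 b := ⟨ht.1.trans ht.2, le_rfl⟩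
  exact (intervalIntegral.integral_interval_sub_left (intervalIntegrable_L2I h h0 hb)
    (intervalIntegrable_L2I h h0 ht)).symm

lemma adjoint_volterra_ae (hb : 0 ≤ b) (h : L2I b) :
    (volterra hb).adjoint h =ᵐ[volume.restrict (Ioc 0 b)] fun t => ∫ x in t..b, h x := by
  have hm := memLp_continuousOn 2 (continuousOn_reverse_primitive h)
  have : (volterra hb).adjoint h = hm.toLp := by
    refine ext_inner_right ℝ fun g => ?_
    rw [ContinuousLinearMap.adjoint_inner_left, L2.inner_def, L2.inner_def]
    calc _ = ∫ x in Ioc 0 b, h x * ∫ s in 0..x, g s := by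
          refine integral_congr_ae ?_
          filter_upwards [volterra_ae hb g] with x hx
          simp [hx, mul_comm]
      _ = ∫ s in Ioc 0 b, (∫ x in s..b, h x) * g s :=
          integral_mul_primitive (integrable_L2I h) (integrable_L2I g)
      _ = _ := by
          refine integral_congr_ae ?_
          filter_upwards [hm.coeFn_toLp] with x hx
          simp [hx, mul_comm]
  rw [this]
  exact hm.coeFn_toLp

end Volterra

/-- Multiplication by an essentially bounded function, as an operator on `L²`. -/
noncomputable def mulL {X : Type*} [MeasurableSpace X] {μ : Measure X} {c : X → ℝ}
    (hc : MemLp c ⊤ μ) : Lp ℝ 2 μ →L[ℝ] Lp ℝ 2 μ :=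
  (ContinuousLinearMap.lsmul ℝ ℝ).holderL μ ⊤ 2 2 hc.toLp

lemma mulL_ae {X : Type*} [MeasurableSpace X] {μ : Measure X} {c : X → ℝ}
    (hc : MemLp c ⊤ μ) (h : Lp ℝ 2 μ) : mulL hc h =ᵐ[μ] fun x => c x * h x := by
  filter_upwards [(ContinuousLinearMap.lsmul ℝ ℝ).coeFn_holder (r := 2) hc.toLp h,
    hc.coeFn_toLp] with x h1 h2
  refine h1.trans ?_
  simp [h2]

lemma inner_mulL {X : Type*} [MeasurableSpace X] {μ : Measure X} {c : X → ℝ}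
    (hc : MemLp c ⊤ μ) (g h : Lp ℝ 2 μ) : inner ℝ (mulL hc g) h = inner ℝ g (mulL hc h) := by
  rw [L2.inner_def, L2.inner_def]
  refine integral_congr_ae ?_
  filter_upwards [mulL_ae hc g, mulL_ae hc h] with x h1 h2
  simp [h1, h2]
  ring

/-! ### Completeness of the Dirichlet eigenfunctions through a compact Green operator. -/

section SturmLiouville

variable {u : ℝ → ℝ}

lemma continuousOn_sqrt_weight (hu : ContinuousOn u (Icc 0 Real.pi)) :
    ContinuousOn (fun x => √(u x)) (Icc 0 Real.pi) := hu.sqrt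

lemma continuousOn_inv_sqrt_weight (hu : ContinuousOn u (Icc 0 Real.pi))
    (hpos : ∀ x ∈ Icc 0 Real.pi, 0 < u x) :
    ContinuousOn (fun x => (√(u x))⁻¹) (Icc 0 Real.pi) :=
  hu.sqrt.inv₀ fun x hx => (Real.sqrt_pos.2 (hpos x hx)).ne'

/-- The operator `h ↦ √u ∫₀ˣ h / √u` on `L²(0, π)`. -/
noncomputable def weightedVolterra (hu : ContinuousOn u (Icc 0 Real.pi))
    (hpos : ∀ x ∈ Icc 0 Real.pi, 0 < u x) : L2I Real.pi →L[ℝ] L2I Real.pi :=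
  mulL (memLp_continuousOn ⊤ (continuousOn_sqrt_weight hu)) ∘L volterra Real.pi_pos.le ∘L
    mulL (memLp_continuousOn ⊤ (continuousOn_inv_sqrt_weight hu hpos))

/-- The function `1 / √u` as an element of `L²(0, π)`. -/
noncomputable def invSqrtWeight (hu : ContinuousOn u (Icc 0 Real.pi))
    (hpos : ∀ x ∈ Icc 0 Real.pi, 0 < u x) : L2I Real.pi :=
  (memLp_continuousOn 2 (continuousOn_inv_sqrt_weight hu hpos)).toLp

/-- `weightedVolterra` restricted to the orthogonal complement of `1 / √u`. -/
noncomputable def halfGreen (hu : ContinuousOn u (Icc 0 Real.pi))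
    (hpos : ∀ x ∈ Icc 0 Real.pi, 0 < u x) : L2I Real.pi →L[ℝ] L2I Real.pi :=
  weightedVolterra hu hpos ∘L (Submodule.span ℝ {invSqrtWeight hu hpos})ᗮ.starProjection

/-- The Green operator of the Dirichlet problem for `-(u φ')' = u h`, conjugated by `√u`. -/
noncomputable def greenOp (hu : ContinuousOn u (Icc 0 Real.pi))
    (hpos : ∀ x ∈ Icc 0 Real.pi, 0 < u x) : L2I Real.pi →L[ℝ] L2I Real.pi :=
  halfGreen hu hpos ∘L (halfGreen hu hpos).adjoint

lemma isCompactOperator_greenOp (hu : ContinuousOn u (Icc 0 Real.pi))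
    (hpos : ∀ x ∈ Icc 0 Real.pi, 0 < u x) : IsCompactOperator (greenOp hu hpos) := by
  have h1 := (isCompactOperator_volterra Real.pi_pos.le).clm_comp
    (mulL (memLp_continuousOn ⊤ (continuousOn_sqrt_weight hu)))
  exact ((h1.comp_clm (mulL (memLp_continuousOn ⊤ (continuousOn_inv_sqrt_weight hu hpos)))).comp_clm
    (Submodule.span ℝ {invSqrtWeight hu hpos})ᗮ.starProjection).comp_clm
      (halfGreen hu hpos).adjoint

lemma isSymmetric_greenOp (hu : ContinuousOn u (Icc 0 Real.pi))
    (hpos : ∀ x ∈ Icc 0 Real.pi, 0 < u x) :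
    (greenOp hu hpos : L2I Real.pi →ₗ[ℝ] L2I Real.pi).IsSymmetric := by
  intro g h
  simp only [greenOp, ContinuousLinearMap.coe_coe, ContinuousLinearMap.comp_apply]
  rw [← ContinuousLinearMap.adjoint_inner_right, ContinuousLinearMap.adjoint_inner_left]

lemma weightedVolterra_ae (hu : ContinuousOn u (Icc 0 Real.pi))
    (hpos : ∀ x ∈ Icc 0 Real.pi, 0 < u x) (k : L2I Real.pi) :
    weightedVolterra hu hpos k =ᵐ[volume.restrict (Ioc 0 Real.pi)] fun x => √(u x) *
      ∫ s in 0..x, mulL (memLp_continuousOn ⊤ (continuousOn_inv_sqrt_weight hu hpos)) k s := by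
  filter_upwards [mulL_ae (memLp_continuousOn ⊤ (continuousOn_sqrt_weight hu))
    (volterra Real.pi_pos.le (mulL (memLp_continuousOn ⊤ (continuousOn_inv_sqrt_weight hu hpos)) k)),
    volterra_ae Real.pi_pos.le
      (mulL (memLp_continuousOn ⊤ (continuousOn_inv_sqrt_weight hu hpos)) k)] with x h1 h2
  rw [← h2, ← h1]
  rfl

lemma adjoint_mulL {X : Type*} [MeasurableSpace X] {μ : Measure X} {c : X → ℝ}
    (hc : MemLp c ⊤ μ) : (mulL hc).adjoint = mulL hc := by
  refine ContinuousLinearMap.ext fun g => ext_inner_right ℝ fun h => ?_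
  rw [ContinuousLinearMap.adjoint_inner_left, inner_mulL]

lemma adjoint_weightedVolterra_ae (hu : ContinuousOn u (Icc 0 Real.pi))
    (hpos : ∀ x ∈ Icc 0 Real.pi, 0 < u x) (h : L2I Real.pi) :
    (weightedVolterra hu hpos).adjoint h =ᵐ[volume.restrict (Ioc 0 Real.pi)] fun x =>
      (√(u x))⁻¹ * ∫ s in x..Real.pi,
        mulL (memLp_continuousOn ⊤ (continuousOn_sqrt_weight hu)) h s := by
  rw [weightedVolterra, ContinuousLinearMap.adjoint_comp, ContinuousLinearMap.adjoint_comp,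
    adjoint_mulL, adjoint_mulL]
  filter_upwards [mulL_ae (memLp_continuousOn ⊤ (continuousOn_inv_sqrt_weight hu hpos))
    ((volterra Real.pi_pos.le).adjoint
      (mulL (memLp_continuousOn ⊤ (continuousOn_sqrt_weight hu)) h)),
    adjoint_volterra_ae Real.pi_pos.le
      (mulL (memLp_continuousOn ⊤ (continuousOn_sqrt_weight hu)) h)] with x h1 h2
  rw [← h2, ← h1]
  rfl

/-- `halfGreen` adjoint in explicit form. -/
lemma exists_adjoint_halfGreen_ae (hu : ContinuousOn u (Icc 0 Real.pi))
    (hpos : ∀ x ∈ Icc 0 Real.pi, 0 < u x) (h : L2I Real.pi) :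
    ∃ c : ℝ, (halfGreen hu hpos).adjoint h =ᵐ[volume.restrict (Ioc 0 Real.pi)] fun x =>
      (√(u x))⁻¹ * ((∫ s in x..Real.pi,
        mulL (memLp_continuousOn ⊤ (continuousOn_sqrt_weight hu)) h s) - c) := by
  set c₀ := invSqrtWeight hu hpos with hc₀
  set k := (weightedVolterra hu hpos).adjoint h with hk
  have h1 : (halfGreen hu hpos).adjoint h = (Submodule.span ℝ {c₀})ᗮ.starProjection k := by
    rw [halfGreen, ContinuousLinearMap.adjoint_comp,
      (ContinuousLinearMap.isSelfAdjoint_iff'.1 (isSelfAdjoint_starProjection _))]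
    rfl
  have h2 : k - (Submodule.span ℝ {c₀})ᗮ.starProjection k ∈ (Submodule.span ℝ {c₀})ᗮᗮ :=
    Submodule.sub_starProjection_mem_orthogonal k
  rw [Submodule.orthogonal_orthogonal, Submodule.mem_span_singleton] at h2
  obtain ⟨c, hc⟩ := h2
  refine ⟨c, ?_⟩
  have h3 : (halfGreen hu hpos).adjoint h = k - c • c₀ := by rw [h1, hc]; abel
  rw [h3]
  filter_upwards [Lp.coeFn_sub k (c • c₀), Lp.coeFn_smul c c₀,
    (memLp_continuousOn 2 (continuousOn_inv_sqrt_weight hu hpos)).coeFn_toLp,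
    adjoint_weightedVolterra_ae hu hpos h] with x e1 e2 e3 e4
  rw [e1, Pi.sub_apply, e2, Pi.smul_apply, hk, e4, hc₀, invSqrtWeight, e3, smul_eq_mul]
  ring

/-- Continuity upgrades the a.e. identity to all of `[0, b]`; Lebesgue differentiation then recovers
`h` as the derivative of a constant. -/
lemma ae_eq_zero_of_reverse_primitive_ae_const {b : ℝ} (h : L2I b) (c : ℝ)
    (hc : ∀ᵐ x ∂(volume.restrict (Ioc 0 b)), ∫ s in x..b, h s = c) : h = 0 := by
  rcases le_or_gt b 0 with hb | hb
  · refine Lp.ext (ae_restrict_of_forall_mem measurableSet_Ioc fun x hx => ?_)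
    exact absurd (hx.1.trans_le hx.2) hb.not_gt
  have h1 : EqOn (fun x => ∫ s in x..b, h s) (fun _ => c) (Icc 0 b) := by
    refine Measure.eqOn_Icc_of_ae_eq volume hb.ne ?_ (continuousOn_reverse_primitive h)
      continuousOn_const
    rw [Measure.restrict_congr_set Ioc_ae_eq_Icc.symm]
    exact hc
  have h0 : (0 : ℝ) ∈ Icc 0 b := ⟨le_rfl, hb.le⟩
  have hbb : b ∈ Icc 0 b := ⟨hb.le, le_rfl⟩
  have h2 := (intervalIntegrable_L2I h h0 hbb).ae_hasDerivAt_integral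
  refine Lp.ext ?_
  have h3 : ∀ᵐ x ∂(volume.restrict (Ioc 0 b)), x ∈ Ioo 0 b := by
    rw [Measure.restrict_congr_set Ioo_ae_eq_Ioc.symm]
    exact ae_restrict_mem measurableSet_Ioo
  filter_upwards [ae_restrict_of_ae h2, h3, Lp.coeFn_zero ℝ 2 (volume.restrict (Ioc 0 b))]
    with x h4 h5 h6
  rw [h6, Pi.zero_apply]
  rw [uIcc_of_le hb.le] at h4
  have h7 := h4 (Ioo_subset_Icc_self h5) b hbb
  have h8 : HasDerivAt (fun x => ∫ s in b..x, h s) 0 x := by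
    refine (hasDerivAt_const x (-c)).congr_of_eventuallyEq ?_
    filter_upwards [Ioo_mem_nhds h5.1 h5.2] with y hy
    rw [intervalIntegral.integral_symm]
    exact congrArg Neg.neg (h1 (Ioo_subset_Icc_self hy))
  exact h7.unique h8

lemma sqrt_mul_eq_zero_of_mulL_eq_zero (hu : ContinuousOn u (Icc 0 Real.pi))
    (hpos : ∀ x ∈ Icc 0 Real.pi, 0 < u x) (h : L2I Real.pi)
    (h0 : mulL (memLp_continuousOn ⊤ (continuousOn_sqrt_weight hu)) h = 0) : h = 0 := by
  refine Lp.ext ?_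
  filter_upwards [mulL_ae (memLp_continuousOn ⊤ (continuousOn_sqrt_weight hu)) h,
    Lp.coeFn_zero ℝ 2 (volume.restrict (Ioc 0 Real.pi)), ae_restrict_mem measurableSet_Ioc]
    with x e1 e2 e3
  rw [h0, e2] at e1
  rw [e2]
  have := (Real.sqrt_pos.2 (hpos x (Ioc_subset_Icc_self e3))).ne'
  simpa [this] using e1.symm

/-- The operator has the form `A A*`, so `A A* h = 0` forces `A* h = 0`. The explicit form of `A* h`
then says that the reverse primitive of `√u h` is constant. -/
lemma greenOp_injective (hu : ContinuousOn u (Icc 0 Real.pi))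
    (hpos : ∀ x ∈ Icc 0 Real.pi, 0 < u x) (h : L2I Real.pi) (h0 : greenOp hu hpos h = 0) :
    h = 0 := by
  have h1 : (halfGreen hu hpos).adjoint h = 0 := by
    rw [← inner_self_eq_zero (𝕜 := ℝ), ContinuousLinearMap.adjoint_inner_left]
    change inner ℝ h (greenOp hu hpos h) = 0
    rw [h0, inner_zero_right]
  obtain ⟨c, hc⟩ := exists_adjoint_halfGreen_ae hu hpos h
  rw [h1] at hc
  refine sqrt_mul_eq_zero_of_mulL_eq_zero hu hpos h
    (ae_eq_zero_of_reverse_primitive_ae_const _ c ?_)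
  filter_upwards [hc, Lp.coeFn_zero ℝ 2 (volume.restrict (Ioc 0 Real.pi)),
    ae_restrict_mem measurableSet_Ioc] with x e1 e2 e3
  rw [e2, Pi.zero_apply] at e1
  have := (Real.sqrt_pos.2 (hpos x (Ioc_subset_Icc_self e3))).ne'
  rw [eq_comm, mul_eq_zero, inv_eq_zero, or_iff_right this, sub_eq_zero] at e1
  exact e1

/-- A continuously differentiable solution of the first-order Sturm-Liouville system is an
eigenfunction. -/
lemma isDirichletEigenpair_of_system (hu : ContDiffOn ℝ 2 u (Icc 0 Real.pi))
    (hpos : ∀ x ∈ Icc 0 Real.pi, 0 < u x) {ν : ℝ} {φ Q : ℝ → ℝ}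
    (hφ : ∀ x ∈ Icc 0 Real.pi, HasDerivAt φ (Q x / u x) x)
    (hQ : ContDiff ℝ 1 Q)
    (hQ' : ∀ x ∈ Icc 0 Real.pi, HasDerivAt Q (-ν * u x * φ x) x)
    (h0 : φ 0 = 0) (hpi : φ Real.pi = 0) (hne : ∃ x ∈ Icc 0 Real.pi, φ x ≠ 0) :
    IsDirichletEigenpair u ν φ := by
  refine ⟨?_, h0, hpi, ?_, hne⟩
  · have hud : UniqueDiffOn ℝ (Icc 0 Real.pi) := uniqueDiffOn_Icc Real.pi_pos
    rw [show (2 : WithTop ℕ∞) = 1 + 1 by norm_num, contDiffOn_succ_iff_derivWithin hud]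
    refine ⟨fun x hx => (hφ x hx).differentiableAt.differentiableWithinAt, by simp, ?_⟩
    have : ContDiffOn ℝ 1 (fun x => Q x / u x) (Icc 0 Real.pi) :=
      hQ.contDiffOn.div (hu.of_le (by norm_num)) fun x hx => (hpos x hx).ne'
    exact this.congr fun x hx => (hφ x hx).hasDerivWithinAt.derivWithin (hud x hx)
  · intro x hx
    have : (fun s => u s * deriv φ s) =ᶠ[𝓝 x] Q := by
      filter_upwards [Ioo_mem_nhds hx.1 hx.2] with s hs
      rw [(hφ s (Ioo_subset_Icc_self hs)).deriv]
      field_simp [(hpos s (Ioo_subset_Icc_self hs)).ne']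
    rw [this.deriv_eq, (hQ' x (Ioo_subset_Icc_self hx)).deriv]

/-- With `h = √u φ`, the equation `A A* h = κ h` reads `κ u φ' = ∫ₓ^π u φ - c`, where `c` comes from
the projection; differentiating once more gives the eigenvalue equation with `ν = 1/κ`. Integration
from `0` gives the left boundary condition, orthogonality to `1/√u` the right one. Continuous
extensions beyond `[0, π]` provide two-sided derivatives at the end points. -/
lemma exists_eigenpair_of_greenOp (hu : ContDiffOn ℝ 2 u (Icc 0 Real.pi))
    (hpos : ∀ x ∈ Icc 0 Real.pi, 0 < u x) {κ : ℝ} (hκ : κ ≠ 0) {h : L2I Real.pi} (hne : h ≠ 0)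
    (hh : greenOp hu.continuousOn hpos h = κ • h) :
    ∃ φ, IsDirichletEigenpair u κ⁻¹ φ ∧
      h =ᵐ[volume.restrict (Ioc 0 Real.pi)] fun x => √(u x) * φ x := by
  have hπ := Real.pi_pos
  have huc := hu.continuousOn
  set k := (halfGreen huc hpos).adjoint h with hk
  obtain ⟨c, hc⟩ := exists_adjoint_halfGreen_ae huc hpos h
  set H := mulL (memLp_continuousOn ⊤ (continuousOn_sqrt_weight huc)) h with hH
  have Hae := mulL_ae (memLp_continuousOn ⊤ (continuousOn_sqrt_weight huc)) h
  set c₀ := invSqrtWeight huc hpos with hc₀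
  set k' := (Submodule.span ℝ {c₀})ᗮ.starProjection k with hk'
  -- `A* h` already lies in the range of the projection, so `A A* h` is the unprojected Volterra
  -- operator applied to `A* h`.
  have hkk : k' = k := by
    rw [hk', Submodule.starProjection_eq_self_iff]
    have h1 : k = (Submodule.span ℝ {c₀})ᗮ.starProjection ((weightedVolterra huc hpos).adjoint h) := by
      rw [hk, halfGreen, ContinuousLinearMap.adjoint_comp,
        (ContinuousLinearMap.isSelfAdjoint_iff'.1 (isSelfAdjoint_starProjection _))]
      rfl
    rw [h1]
    exact Submodule.starProjection_apply_mem _ _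
  have hRk : weightedVolterra huc hpos k = κ • h := by
    rw [← hh, ← hkk]
    rfl
  set K := mulL (memLp_continuousOn ⊤ (continuousOn_inv_sqrt_weight huc hpos)) k with hK
  have Kae := mulL_ae (memLp_continuousOn ⊤ (continuousOn_inv_sqrt_weight huc hpos)) k
  have Rae := weightedVolterra_ae huc hpos k
  rw [hRk] at Rae
  -- global continuous versions
  let U : ℝ → ℝ := IccExtend hπ.le ((Icc 0 Real.pi).domRestrict u)
  have hUc : Continuous U := (continuousOn_iff_continuous_domRestrict.1 huc).Icc_extend'
  have hUu : ∀ x ∈ Icc 0 Real.pi, U x = u x := fun x hx => IccExtend_of_mem hπ.le _ hx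
  have hPc : ContinuousOn (fun x => ((∫ s in x..Real.pi, H s) - c) / u x) (Icc 0 Real.pi) :=
    ((continuousOn_reverse_primitive H).sub continuousOn_const).div huc
      fun x hx => (hpos x hx).ne'
  let p : ℝ → ℝ := IccExtend hπ.le ((Icc 0 Real.pi).domRestrict
    fun x => ((∫ s in x..Real.pi, H s) - c) / u x)
  have hpc : Continuous p := (continuousOn_iff_continuous_domRestrict.1 hPc).Icc_extend'
  have hpP : ∀ x ∈ Icc 0 Real.pi, p x = ((∫ s in x..Real.pi, H s) - c) / u x :=
    fun x hx => IccExtend_of_mem hπ.le _ hx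
  have Kp : K =ᵐ[volume.restrict (Ioc 0 Real.pi)] p := by
    filter_upwards [Kae, hc, ae_restrict_mem measurableSet_Ioc] with x e1 e2 e3
    have hx := Ioc_subset_Icc_self e3
    rw [hK, e1, e2, hpP x hx, ← mul_assoc, ← mul_inv, Real.mul_self_sqrt (hpos x hx).le]
    field_simp
  have Kint : ∀ x ∈ Icc 0 Real.pi, ∫ s in 0..x, K s = ∫ s in 0..x, p s := by
    intro x hx
    rw [intervalIntegral.integral_of_le hx.1, intervalIntegral.integral_of_le hx.1]
    exact integral_congr_ae (ae_restrict_of_ae_restrict_of_subset (Ioc_subset_Ioc_right hx.2) Kp)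
  let φ : ℝ → ℝ := fun x => κ⁻¹ * ∫ s in 0..x, p s
  have hφd : ∀ x, HasDerivAt φ (κ⁻¹ * p x) x := fun x =>
    (hpc.integral_hasStrictDerivAt 0 x).hasDerivAt.const_mul _
  have hφc : Continuous φ := continuous_iff_continuousAt.2 fun x => (hφd x).continuousAt
  have hφh : h =ᵐ[volume.restrict (Ioc 0 Real.pi)] fun x => √(u x) * φ x := by
    filter_upwards [Rae, Lp.coeFn_smul κ h, ae_restrict_mem measurableSet_Ioc] with x e1 e2 e3
    rw [e2, Pi.smul_apply, smul_eq_mul, Kint x (Ioc_subset_Icc_self e3)] at e1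
    simp only [φ]
    field_simp
    linarith
  have HUφ : H =ᵐ[volume.restrict (Ioc 0 Real.pi)] fun x => U x * φ x := by
    filter_upwards [Hae, hφh, ae_restrict_mem measurableSet_Ioc] with x e1 e2 e3
    have hx := Ioc_subset_Icc_self e3
    rw [hH, e1, e2, ← mul_assoc, Real.mul_self_sqrt (hpos x hx).le, hUu x hx]
  let Q : ℝ → ℝ := fun x => κ⁻¹ * ((∫ s in 0..Real.pi, H s) - c - ∫ s in 0..x, U s * φ s)
  have hQd : ∀ x, HasDerivAt Q (κ⁻¹ * (- (U x * φ x))) x := fun x =>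
    (((hUc.mul hφc).integral_hasStrictDerivAt 0 x).hasDerivAt.const_sub _).const_mul _
  have hQc : ContDiff ℝ 1 Q := by
    rw [contDiff_one_iff_deriv]
    refine ⟨fun x => (hQd x).differentiableAt, ?_⟩
    rw [show deriv Q = fun x => κ⁻¹ * (- (U x * φ x)) from funext fun x => (hQd x).deriv]
    fun_prop
  have hQP : ∀ x ∈ Icc 0 Real.pi, κ⁻¹ * p x = Q x / u x := by
    intro x hx
    rw [hpP x hx]
    have h0 : (0 : ℝ) ∈ Icc 0 Real.pi := ⟨le_rfl, hπ.le⟩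
    have hb : Real.pi ∈ Icc 0 Real.pi := ⟨hπ.le, le_rfl⟩
    have e1 : ∫ s in 0..x, U s * φ s = ∫ s in 0..x, H s := by
      rw [intervalIntegral.integral_of_le hx.1, intervalIntegral.integral_of_le hx.1]
      exact (integral_congr_ae (ae_restrict_of_ae_restrict_of_subset
        (Ioc_subset_Ioc_right hx.2) HUφ)).symm
    have e2 := intervalIntegral.integral_add_adjacent_intervals
      (intervalIntegrable_L2I H h0 hx) (intervalIntegrable_L2I H hx hb)
    simp only [Q]
    rw [e1, ← e2]
    ring
  refine ⟨φ, isDirichletEigenpair_of_system hu hpos (Q := Q) ?_ hQc ?_ (by simp [φ]) ?_ ?_, hφh⟩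
  · exact fun x hx => hQP x hx ▸ hφd x
  · intro x hx
    convert hQd x using 1
    rw [hUu x hx]
    ring
  -- Orthogonality of `k` to `1/√u` says `∫₀^π k/√u = 0`, which is `φ(π) = 0`.
  · have e1 : inner ℝ c₀ k = 0 := by
      rw [← Submodule.mem_orthogonal_singleton_iff_inner_right, ← hkk]
      exact Submodule.starProjection_apply_mem _ _
    have e2 : ∫ s in 0..Real.pi, K s = 0 := by
      rw [L2.inner_def] at e1
      rw [intervalIntegral.integral_of_le hπ.le]
      refine Eq.trans (integral_congr_ae ?_) e1
      filter_upwards [Kae, (memLp_continuousOn 2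
        (continuousOn_inv_sqrt_weight huc hpos)).coeFn_toLp] with x e3 e4
      rw [hK, e3, hc₀, invSqrtWeight, e4]
      simp [mul_comm]
    simp only [φ]
    rw [← Kint _ ⟨hπ.le, le_rfl⟩, e2, mul_zero]
  · by_contra! hzero
    refine hne (Lp.ext ?_)
    filter_upwards [hφh, Lp.coeFn_zero ℝ 2 (volume.restrict (Ioc 0 Real.pi)),
      ae_restrict_mem measurableSet_Ioc] with x e1 e2 e3
    rw [e1, e2, hzero x (Ioc_subset_Icc_self e3), mul_zero, Pi.zero_apply]

/-- Completeness of the Dirichlet eigenfunctions: countably many of them are total. -/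
theorem exists_countable_total_eigenpairs (hu : ContDiffOn ℝ 2 u (Icc 0 Real.pi))
    (hpos : ∀ x ∈ Icc 0 Real.pi, 0 < u x) :
    ∃ (ι : Type) (_ : Countable ι) (ν : ι → ℝ) (φ : ι → ℝ → ℝ),
      (∀ i, IsDirichletEigenpair u (ν i) (φ i)) ∧
      ∀ h : ℝ → ℝ, MemLp h 2 (volume.restrict (Ioc 0 Real.pi)) →
        (∀ i, ∫ x in Ioc 0 Real.pi, √(u x) * φ i x * h x = 0) →
        h =ᵐ[volume.restrict (Ioc 0 Real.pi)] 0 := by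
  let E : Set (L2I Real.pi) := {v | ∃ ν φ, IsDirichletEigenpair u ν φ ∧
    v =ᵐ[volume.restrict (Ioc 0 Real.pi)] fun x => √(u x) * φ x}
  have : Fact ((2 : ENNReal) ≠ ⊤) := ⟨by norm_num⟩
  -- Separability of `L²` reduces all eigenvectors to a countable dense subfamily. Countability
  -- later allows a single null set of times to serve every eigenfunction.
  obtain ⟨S, hSc, hSd⟩ := TopologicalSpace.exists_countable_dense E
  have hE : ∀ v : E, ∃ νφ : ℝ × (ℝ → ℝ), IsDirichletEigenpair u νφ.1 νφ.2 ∧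
      (v : L2I Real.pi) =ᵐ[volume.restrict (Ioc 0 Real.pi)] fun x => √(u x) * νφ.2 x := by
    rintro ⟨v, ν, φ, h1, h2⟩
    exact ⟨(ν, φ), h1, h2⟩
  choose F hF1 hF2 using hE
  refine ⟨S, hSc.to_subtype, fun i => (F i).1, fun i => (F i).2, fun i => hF1 _,
    fun h hh hint => ?_⟩
  set h' : L2I Real.pi := hh.toLp with hh'
  have hS : ∀ s ∈ S, inner ℝ (s : L2I Real.pi) h' = 0 := by
    intro s hs
    rw [L2.inner_def]
    refine Eq.trans (integral_congr_ae ?_) (hint ⟨s, hs⟩)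
    filter_upwards [hF2 s, hh.coeFn_toLp] with x e1 e2
    rw [e1, hh', e2]
    simp [mul_comm]
  have hall : ∀ v : E, inner ℝ (v : L2I Real.pi) h' = 0 := by
    have hcl : IsClosed {v : E | inner ℝ (v : L2I Real.pi) h' = 0} :=
      isClosed_eq (by fun_prop) continuous_const
    intro v
    exact closure_minimal hS hcl (hSd v)
  have hz : h' = 0 := by
    -- By the spectral theorem for compact symmetric operators the eigenspaces have trivial joint
    -- orthogonal complement; injectivity excludes the eigenvalue `0`, which corresponds to no `ν`.
    have horth : h' ∈ (⨆ μ, Module.End.eigenspace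
        (greenOp hu.continuousOn hpos : L2I Real.pi →ₗ[ℝ] L2I Real.pi) μ)ᗮ := by
      rw [← Submodule.iInf_orthogonal, Submodule.mem_iInf]
      intro κ v hv
      rw [Module.End.mem_eigenspace_iff] at hv
      rcases eq_or_ne v 0 with rfl | hv0
      · simp
      have hκ : κ ≠ 0 := by
        rintro rfl
        exact hv0 (greenOp_injective hu.continuousOn hpos v (by simpa using hv))
      obtain ⟨φ, h1, h2⟩ := exists_eigenpair_of_greenOp hu hpos hκ hv0 hv
      exact hall ⟨v, κ⁻¹, φ, h1, h2⟩
    rw [ContinuousLinearMap.orthogonalComplement_iSup_eigenspaces_eq_bot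
      (isCompactOperator_greenOp hu.continuousOn hpos)
      (isSymmetric_greenOp hu.continuousOn hpos)] at horth
    simpa using horth
  filter_upwards [hh.coeFn_toLp, Lp.coeFn_zero ℝ 2 (volume.restrict (Ioc 0 Real.pi))] with x e1 e2
  rw [← e1, ← hh', hz, e2]

end SturmLiouville

/-! ### Weighted orthogonality of the Dirichlet eigenfunctions. -/

section Orthogonality

variable {u : ℝ → ℝ}

/-- The flux `u φ'`, continuous up to the boundary, with its derivative in the interior. -/
lemma IsDirichletEigenpair.exists_flux (hu : ContDiffOn ℝ 2 u (Icc 0 Real.pi)) {ν : ℝ} {φ : ℝ → ℝ}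
    (h : IsDirichletEigenpair u ν φ) :
    ∃ Q : ℝ → ℝ, ContinuousOn Q (Icc 0 Real.pi) ∧
      (∀ x ∈ Ioo 0 Real.pi, HasDerivAt Q (-ν * u x * φ x) x) ∧
      (∀ x ∈ Ioo 0 Real.pi, Q x = u x * deriv φ x) ∧
      ∀ x ∈ Ioo 0 Real.pi, HasDerivAt φ (deriv φ x) x := by
  have hud : UniqueDiffOn ℝ (Icc 0 Real.pi) := uniqueDiffOn_Icc Real.pi_pos
  have h2 := h.contDiffOn
  rw [show (2 : WithTop ℕ∞) = 1 + 1 by norm_num, contDiffOn_succ_iff_derivWithin hud] at h2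
  have hQ1 : ContDiffOn ℝ 1 (fun x => u x * derivWithin φ (Icc 0 Real.pi) x) (Icc 0 Real.pi) :=
    (hu.of_le (by norm_num)).mul h2.2.2
  have hIcc : ∀ x ∈ Ioo 0 Real.pi, Icc 0 Real.pi ∈ 𝓝 x := fun x hx => Icc_mem_nhds hx.1 hx.2
  have hQe : ∀ x ∈ Ioo 0 Real.pi,
      u x * derivWithin φ (Icc 0 Real.pi) x = u x * deriv φ x := fun x hx => by
    rw [derivWithin_of_mem_nhds (hIcc x hx)]
  refine ⟨_, hQ1.continuousOn, fun x hx => ?_, hQe, fun x hx => ?_⟩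
  · have hd : DifferentiableAt ℝ (fun x => u x * derivWithin φ (Icc 0 Real.pi) x) x :=
      ((hQ1.differentiableOn (by norm_num)) x (Ioo_subset_Icc_self hx)).differentiableAt (hIcc x hx)
    rw [← h.eqn x hx]
    have he : (fun x => u x * derivWithin φ (Icc 0 Real.pi) x) =ᶠ[𝓝 x] fun s => u s * deriv φ s := by
      filter_upwards [Ioo_mem_nhds hx.1 hx.2] with s hs using hQe s hs
    rw [← he.deriv_eq]
    exact hd.hasDerivAt
  · exact ((h2.1 x (Ioo_subset_Icc_self hx)).differentiableAt (hIcc x hx)).hasDerivAt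

lemma IsDirichletEigenpair.continuousOn {ν : ℝ} {φ : ℝ → ℝ} (h : IsDirichletEigenpair u ν φ) :
    ContinuousOn φ (Icc 0 Real.pi) := h.contDiffOn.continuousOn

/-- Eigenfunctions with different eigenvalues are orthogonal with respect to the weight `u`. -/
lemma IsDirichletEigenpair.integral_mul_eq_zero (hu : ContDiffOn ℝ 2 u (Icc 0 Real.pi))
    {ν₁ ν₂ : ℝ} {φ₁ φ₂ : ℝ → ℝ} (h₁ : IsDirichletEigenpair u ν₁ φ₁)
    (h₂ : IsDirichletEigenpair u ν₂ φ₂) (hne : ν₁ ≠ ν₂) :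
    ∫ x in Ioc 0 Real.pi, u x * φ₁ x * φ₂ x = 0 := by
  obtain ⟨Q₁, hc₁, hd₁, he₁, hφ₁⟩ := h₁.exists_flux hu
  obtain ⟨Q₂, hc₂, hd₂, he₂, hφ₂⟩ := h₂.exists_flux hu
  have hcont : ContinuousOn (fun x => u x * φ₁ x * φ₂ x) (Icc 0 Real.pi) :=
    (hu.continuousOn.mul h₁.continuousOn).mul h₂.continuousOn
  -- Lagrange's identity: the terms `u φ₁' φ₂'` cancel in the derivative of `Q₁ φ₂ - Q₂ φ₁`, which
  -- vanishes at both ends.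
  have key := intervalIntegral.integral_eq_sub_of_hasDerivAt_of_le Real.pi_pos.le
    (f := fun x => Q₁ x * φ₂ x - Q₂ x * φ₁ x)
    (f' := fun x => (ν₂ - ν₁) * (u x * φ₁ x * φ₂ x))
    ((hc₁.mul h₂.continuousOn).sub (hc₂.mul h₁.continuousOn))
    (fun x hx => by
      have := ((hd₁ x hx).mul (hφ₂ x hx)).sub ((hd₂ x hx).mul (hφ₁ x hx))
      rw [he₁ x hx, he₂ x hx] at this
      exact this.congr_deriv (by ring))
    ((hcont.intervalIntegrable_of_Icc Real.pi_pos.le).const_mul _)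
  rw [h₁.left, h₁.right, h₂.left, h₂.right, intervalIntegral.integral_const_mul,
    intervalIntegral.integral_of_le Real.pi_pos.le] at key
  have : ν₂ - ν₁ ≠ 0 := sub_ne_zero.2 hne.symm
  simpa [this] using key

end Orthogonality

/-! ### Orthogonality and completeness of the trigonometric system. -/

section Trigonometric

/-- `sin` or `cos`, selected by a Boolean. -/
noncomputable def trig (s : Bool) (θ : ℝ) : ℝ := cond s (Real.sin θ) (Real.cos θ)

lemma continuous_trig (s : Bool) : Continuous (trig s) := by
  cases s
  · exact Real.continuous_cos
  · exact Real.continuous_sin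

lemma abs_trig_le_one (s : Bool) (θ : ℝ) : |trig s θ| ≤ 1 := by
  cases s
  · exact Real.abs_cos_le_one θ
  · exact Real.abs_sin_le_one θ

lemma integral_cos_two_pi_mul {T : ℝ} (hT : 0 < T) {k : ℤ} (hk : k ≠ 0) :
    ∫ t in 0..T, Real.cos (2 * Real.pi / T * k * t) = 0 := by
  have hc : 2 * Real.pi / T * k ≠ 0 := by
    have : (k : ℝ) ≠ 0 := by exact_mod_cast hk
    positivity
  rw [intervalIntegral.integral_comp_mul_left (fun x => Real.cos x) hc, integral_cos]
  have : 2 * Real.pi / T * k * T = (2 * k : ℤ) * Real.pi := by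
    push_cast; field_simp
  rw [this, Real.sin_int_mul_pi]
  simp

lemma integral_sin_two_pi_mul {T : ℝ} (hT : 0 < T) (k : ℤ) :
    ∫ t in 0..T, Real.sin (2 * Real.pi / T * k * t) = 0 := by
  rcases eq_or_ne k 0 with rfl | hk
  · simp
  have hc : 2 * Real.pi / T * k ≠ 0 := by
    have : (k : ℝ) ≠ 0 := by exact_mod_cast hk
    positivity
  rw [intervalIntegral.integral_comp_mul_left (fun x => Real.sin x) hc, integral_sin]
  have : 2 * Real.pi / T * k * T = k * (2 * Real.pi) := by
    field_simp
  rw [this, Real.cos_int_mul_two_pi]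
  simp

/-- Product-to-sum formulas, with `m - n` and `m + n` both nonzero. Sine and cosine of equal
frequency are not compared: they share a label, hence an eigenvalue of the wave operator. -/
lemma integral_trig_mul_trig {T : ℝ} (hT : 0 < T) {m n : ℕ} (hmn : m ≠ n) (s r : Bool) :
    ∫ t in Ioc 0 T, trig s (2 * Real.pi / T * m * t) * trig r (2 * Real.pi / T * n * t) = 0 := by
  rw [← intervalIntegral.integral_of_le hT.le]
  have hd : (m : ℤ) - n ≠ 0 := by omega
  have ha : (m : ℤ) + n ≠ 0 := by omega
  have c1 := integral_cos_two_pi_mul hT hd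
  have c2 := integral_cos_two_pi_mul hT ha
  have s1 := integral_sin_two_pi_mul hT (m - n)
  have s2 := integral_sin_two_pi_mul hT (m + n)
  have ic (k : ℤ) : IntervalIntegrable (fun t => Real.cos (2 * Real.pi / T * k * t)) volume 0 T :=
    Continuous.intervalIntegrable (by fun_prop) _ _
  have is (k : ℤ) : IntervalIntegrable (fun t => Real.sin (2 * Real.pi / T * k * t)) volume 0 T :=
    Continuous.intervalIntegrable (by fun_prop) _ _
  have e1 (t : ℝ) : 2 * Real.pi / T * ((m - n : ℤ) : ℝ) * t =
      2 * Real.pi / T * m * t - 2 * Real.pi / T * n * t := by push_cast; ring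
  have e2 (t : ℝ) : 2 * Real.pi / T * ((m + n : ℤ) : ℝ) * t =
      2 * Real.pi / T * m * t + 2 * Real.pi / T * n * t := by push_cast; ring
  cases s <;> cases r
  · have := intervalIntegral.integral_add (ic (m - n)) (ic (m + n))
    rw [c1, c2, add_zero] at this
    refine (mul_right_inj' (two_ne_zero (α := ℝ))).1 ?_
    rw [mul_zero, ← intervalIntegral.integral_const_mul]
    refine Eq.trans (intervalIntegral.integral_congr fun t _ => ?_) this
    simp only [trig, cond_false, e1, e2, Real.cos_add, Real.cos_sub]
    ring
  · have := intervalIntegral.integral_sub (is (m + n)) (is (m - n))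
    rw [s1, s2, sub_zero] at this
    refine (mul_right_inj' (two_ne_zero (α := ℝ))).1 ?_
    rw [mul_zero, ← intervalIntegral.integral_const_mul]
    refine Eq.trans (intervalIntegral.integral_congr fun t _ => ?_) this
    simp only [trig, cond_false, cond_true, e1, e2, Real.sin_add, Real.sin_sub]
    ring
  · have := intervalIntegral.integral_add (is (m + n)) (is (m - n))
    rw [s1, s2, add_zero] at this
    refine (mul_right_inj' (two_ne_zero (α := ℝ))).1 ?_
    rw [mul_zero, ← intervalIntegral.integral_const_mul]
    refine Eq.trans (intervalIntegral.integral_congr fun t _ => ?_) this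
    simp only [trig, cond_false, cond_true, e1, e2, Real.sin_add, Real.sin_sub]
    ring
  · have := intervalIntegral.integral_sub (ic (m - n)) (ic (m + n))
    rw [c1, c2, sub_zero] at this
    refine (mul_right_inj' (two_ne_zero (α := ℝ))).1 ?_
    rw [mul_zero, ← intervalIntegral.integral_const_mul]
    refine Eq.trans (intervalIntegral.integral_congr fun t _ => ?_) this
    simp only [trig, cond_true, e1, e2, Real.cos_add, Real.cos_sub]
    ring

/-- Completeness of the real trigonometric system in `L²(0, T)`. -/
lemma ae_eq_zero_of_integral_trig {T : ℝ} (hT : 0 < T) {c : ℝ → ℝ}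
    (hc : MemLp c 2 (volume.restrict (Ioc 0 T)))
    (h : ∀ (s : Bool) (m : ℕ), ∫ t in Ioc 0 T, trig s (2 * Real.pi / T * m * t) * c t = 0) :
    c =ᵐ[volume.restrict (Ioc 0 T)] 0 := by
  have hci : Integrable c (volume.restrict (Ioc 0 T)) := hc.integrable (by norm_num)
  have hcC : MemLp (fun t => (c t : ℂ)) 2 (volume.restrict (Ioc 0 T)) := hc.ofReal
  have hcos (n : ℤ) : ∫ t in Ioc 0 T, Real.cos (2 * Real.pi / T * n * t) * c t = 0 := by
    rcases Int.natAbs_eq n with hn | hn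
    · refine Eq.trans (integral_congr_ae (ae_of_all _ fun t => ?_)) (h false n.natAbs)
      simp only [trig, cond_false]
      conv_lhs => rw [hn]
      rw [Int.cast_natCast]
    · refine Eq.trans (integral_congr_ae (ae_of_all _ fun t => ?_)) (h false n.natAbs)
      simp only [trig, cond_false]
      conv_lhs => rw [hn]
      rw [← Real.cos_neg]
      rw [Int.cast_neg, Int.cast_natCast]
      ring_nf
  have hsin (n : ℤ) : ∫ t in Ioc 0 T, Real.sin (2 * Real.pi / T * n * t) * c t = 0 := by
    rcases Int.natAbs_eq n with hn | hn
    · refine Eq.trans (integral_congr_ae (ae_of_all _ fun t => ?_)) (h true n.natAbs)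
      simp only [trig, cond_true]
      conv_lhs => rw [hn]
      rw [Int.cast_natCast]
    · rw [← neg_eq_zero, ← integral_neg]
      refine Eq.trans (integral_congr_ae (ae_of_all _ fun t => ?_)) (h true n.natAbs)
      simp only [trig, cond_true]
      conv_lhs => rw [hn]
      rw [← neg_mul, ← Real.sin_neg]
      rw [Int.cast_neg, Int.cast_natCast]
      ring_nf
  have hzero (n : ℤ) : fourierCoeffOn hT (fun t => (c t : ℂ)) n = 0 := by
    rw [fourierCoeffOn_eq_integral, smul_eq_zero]
    right
    rw [intervalIntegral.integral_of_le hT.le]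
    have e : ∀ t : ℝ, (fourier (-n) (t : AddCircle (T - 0)) : ℂ) • (c t : ℂ) =
        ((Real.cos (2 * Real.pi / T * (-n : ℤ) * t) * c t : ℝ) : ℂ) +
          ((Real.sin (2 * Real.pi / T * (-n : ℤ) * t) * c t : ℝ) : ℂ) * Complex.I := by
      intro t
      rw [fourier_coe_apply, sub_zero, smul_eq_mul]
      have : 2 * (Real.pi : ℂ) * Complex.I * ((-n : ℤ) : ℂ) * (t : ℂ) / (T : ℂ) =
          ((2 * Real.pi / T * (-n : ℤ) * t : ℝ) : ℂ) * Complex.I := by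
        push_cast; ring
      rw [this, Complex.exp_mul_I, ← Complex.ofReal_cos, ← Complex.ofReal_sin]
      push_cast
      ring
    have i1 : Integrable (fun t => Real.cos (2 * Real.pi / T * (-n : ℤ) * t) * c t)
        (volume.restrict (Ioc 0 T)) :=
      hci.bdd_mul (c := 1) (Continuous.aestronglyMeasurable (by fun_prop))
        (ae_of_all _ fun t => Real.abs_cos_le_one _)
    have i2 : Integrable (fun t => Real.sin (2 * Real.pi / T * (-n : ℤ) * t) * c t)
        (volume.restrict (Ioc 0 T)) :=
      hci.bdd_mul (c := 1) (Continuous.aestronglyMeasurable (by fun_prop))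
        (ae_of_all _ fun t => Real.abs_sin_le_one _)
    simp_rw [e]
    rw [integral_add i1.ofReal (i2.ofReal.mul_const _), integral_mul_const]
    have k1 := hcos (-n)
    have k2 := hsin (-n)
    rw [← Complex.ofReal_inj, ← integral_complex_ofReal] at k1 k2
    rw [k1, k2]
    simp
  -- Parseval: all complex Fourier coefficients vanish, so the `L²` norm does.
  have hsum := hasSum_sq_fourierCoeffOn hT hcC
  simp only [hzero, norm_zero, ne_eq, OfNat.ofNat_ne_zero, not_false_eq_true, zero_pow] at hsum
  have h0 := hsum.unique hasSum_zero
  rw [smul_eq_zero, intervalIntegral.integral_of_le hT.le] at h0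
  have h1 := h0.resolve_left (by rw [sub_zero]; positivity)
  rw [integral_eq_zero_iff_of_nonneg (fun _ => by positivity)
    (hcC.norm.integrable_sq)] at h1
  filter_upwards [h1] with t ht
  simpa using ht

end Trigonometric

/-! ### Square integrability on product spaces. -/

section SquareIntegrable

variable {X Y : Type*} [MeasurableSpace X] [MeasurableSpace Y] {μ : Measure X} {ν : Measure Y}

lemma inner_toLp_toLp {f g : X → ℝ} (hf : MemLp f 2 μ) (hg : MemLp g 2 μ) :
    inner ℝ hf.toLp hg.toLp = ∫ x, f x * g x ∂μ := by
  rw [L2.inner_def]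
  refine integral_congr_ae ?_
  filter_upwards [hf.coeFn_toLp, hg.coeFn_toLp] with x e1 e2
  rw [e1, e2]
  simp [mul_comm]

lemma sq_integral_mul_le {f g : X → ℝ} (hf : MemLp f 2 μ) (hg : MemLp g 2 μ) :
    (∫ x, f x * g x ∂μ) ^ 2 ≤ (∫ x, f x ^ 2 ∂μ) * ∫ x, g x ^ 2 ∂μ := by
  have h := real_inner_mul_inner_self_le hf.toLp hg.toLp
  rw [inner_toLp_toLp, inner_toLp_toLp, inner_toLp_toLp] at h
  simpa only [pow_two] using h

lemma MemLp.ae_memLp_two_prodMk [SFinite ν] [SFinite μ] {F : X × Y → ℝ}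
    (hF : MemLp F 2 (μ.prod ν)) : ∀ᵐ x ∂μ, MemLp (fun y => F (x, y)) 2 ν := by
  filter_upwards [hF.integrable_sq.prod_right_ae, hF.1.prodMk_left] with x h1 h2
  exact (memLp_two_iff_integrable_sq h2).2 h1

/-- Cauchy–Schwarz in each fibre bounds the square of the partial integral by `∫ g²` times the fibre
integral of `F²`, which is integrable by Fubini. -/
lemma MemLp.integral_mul_prod [SFinite ν] [SFinite μ] {F : X × Y → ℝ} {g : Y → ℝ}
    (hF : MemLp F 2 (μ.prod ν)) (hg : MemLp g 2 ν) :
    MemLp (fun x => ∫ y, g y * F (x, y) ∂ν) 2 μ := by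
  have hm : AEStronglyMeasurable (fun x => ∫ y, g y * F (x, y) ∂ν) μ :=
    AEStronglyMeasurable.integral_prod_right' (f := fun z : X × Y => g z.2 * F z)
      (hg.1.comp_snd.mul hF.1)
  rw [memLp_two_iff_integrable_sq hm]
  refine ((hF.integrable_sq.integral_prod_left).const_mul (∫ y, g y ^ 2 ∂ν)).mono' (hm.pow 2) ?_
  filter_upwards [MemLp.ae_memLp_two_prodMk hF] with x hx
  rw [Real.norm_of_nonneg (sq_nonneg _)]
  exact sq_integral_mul_le hg hx

end SquareIntegrable

/-! ### The space-time modes: coefficients, orthogonality, completeness. -/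

section Modes

variable {u : ℝ → ℝ} {T : ℝ}

lemma dom_eq_prod (T : ℝ) :
    dom T = (volume.restrict (Ioc 0 T)).prod (volume.restrict (Ioc 0 Real.pi)) := by
  rw [dom, domain, Measure.volume_eq_prod, ← Measure.prod_restrict,
    Measure.restrict_congr_set Ioo_ae_eq_Ioc, Measure.restrict_congr_set Ioo_ae_eq_Ioc]

instance isFiniteMeasure_dom (T : ℝ) : IsFiniteMeasure (dom T) := by
  rw [dom_eq_prod]; infer_instance

lemma measurableSet_domain (T : ℝ) : MeasurableSet (domain T) :=
  measurableSet_Ioo.prod measurableSet_Ioo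

lemma ae_mem_domain (T : ℝ) : ∀ᵐ z ∂(dom T), z ∈ domain T :=
  ae_restrict_mem (measurableSet_domain T)

lemma memLp_top_comp_snd {g : ℝ → ℝ} (hg : ContinuousOn g (Icc 0 Real.pi)) :
    MemLp (fun z : ℝ × ℝ => g z.2) ⊤ (dom T) := by
  obtain ⟨C, hC⟩ := isCompact_Icc.exists_bound_of_continuousOn hg
  have hmaps : MapsTo (fun z : ℝ × ℝ => z.2) (domain T) (Icc 0 Real.pi) :=
    fun z hz => Ioo_subset_Icc_self hz.2
  refine MemLp.of_bound ((hg.comp continuousOn_snd hmaps).aestronglyMeasurable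
    (measurableSet_domain T)) C ?_
  filter_upwards [ae_mem_domain T] with z hz using hC _ (hmaps hz)

/-- On the compact interval `u` is bounded above and away from zero, so the weight changes the norm
but not the space. -/
lemma memL2_iff_memLp (hu : ContinuousOn u (Icc 0 Real.pi))
    (hpos : ∀ x ∈ Icc 0 Real.pi, 0 < u x) (y : ℝ × ℝ → ℝ) :
    MemL2 u T y ↔ MemLp y 2 (dom T) := by
  have h1 := memLp_top_comp_snd (T := T) hu
  have h2 := memLp_top_comp_snd (T := T) (hu.inv₀ fun x hx => (hpos x hx).ne')
  constructor
  · rintro ⟨hm, hi⟩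
    rw [memLp_two_iff_integrable_sq hm]
    refine (hi.mul_of_top_right h2).congr ?_
    filter_upwards [ae_mem_domain T] with z hz
    have := (hpos z.2 (Ioo_subset_Icc_self hz.2)).ne'
    simp only [Pi.mul_apply, sq_abs, Pi.inv_apply]
    field_simp
  · intro h
    refine ⟨h.1, (h.integrable_sq.mul_of_top_right h1).congr (ae_of_all _ fun z => ?_)⟩
    simp

/-- The product `√u φ(x) trig(2πmt/T)`, where `trig` is `sin` or `cos`. -/
noncomputable def mode (u : ℝ → ℝ) (T : ℝ) (s : Bool) (φ : ℝ → ℝ) (m : ℕ) (z : ℝ × ℝ) : ℝ :=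
  √(u z.2) * (φ z.2 * trig s (2 * Real.pi / T * m * z.1))

/-- `sinCoeff` or `cosCoeff`, selected by a Boolean. -/
noncomputable def modeCoeff (u : ℝ → ℝ) (T : ℝ) (s : Bool) (φ : ℝ → ℝ) (m : ℕ)
    (y : ℝ × ℝ → ℝ) : ℝ :=
  ∫ z, u z.2 * y z * (φ z.2 * trig s (2 * Real.pi / T * m * z.1)) ∂(dom T)

lemma waveOp_iff (hu : ContinuousOn u (Icc 0 Real.pi))
    (hpos : ∀ x ∈ Icc 0 Real.pi, 0 < u x) (y g : ℝ × ℝ → ℝ) :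
    WaveOp u T y g ↔ MemLp y 2 (dom T) ∧ MemLp g 2 (dom T) ∧
      ∀ ν φ, IsDirichletEigenpair u ν φ → ∀ s m,
        modeCoeff u T s φ m g = (ν - (2 * Real.pi / T * m) ^ 2) * modeCoeff u T s φ m y := by
  rw [WaveOp, memL2_iff_memLp hu hpos, memL2_iff_memLp hu hpos]
  refine and_congr_right fun _ => and_congr_right fun _ => ?_
  refine forall_congr' fun ν => forall_congr' fun φ => forall_congr' fun _ => ?_
  exact ⟨fun h s m => s.rec (h m).1 (h m).2, fun h m => ⟨h false m, h true m⟩⟩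

lemma memLp_top_trig (s : Bool) (c : ℝ) :
    MemLp (fun z : ℝ × ℝ => trig s (c * z.1)) ⊤ (dom T) :=
  MemLp.of_bound ((continuous_trig s).comp (by fun_prop)).aestronglyMeasurable 1
    (ae_of_all _ fun _ => abs_trig_le_one _ _)

lemma memLp_mode (hu : ContinuousOn u (Icc 0 Real.pi)) {φ : ℝ → ℝ}
    (hφ : ContinuousOn φ (Icc 0 Real.pi)) (s : Bool) (m : ℕ) :
    MemLp (mode u T s φ m) 2 (dom T) := by
  have h : MemLp (fun z : ℝ × ℝ => φ z.2) 2 (dom T) :=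
    (memLp_top_comp_snd hφ).mono_exponent le_top
  exact ((memLp_top_trig s (2 * Real.pi / T * m)).mul' (r := 2) h).mul' (r := 2)
      (memLp_top_comp_snd (continuousOn_sqrt_weight hu))

lemma memLp_sqrt_mul (hu : ContinuousOn u (Icc 0 Real.pi)) {y : ℝ × ℝ → ℝ}
    (hy : MemLp y 2 (dom T)) : MemLp (fun z => √(u z.2) * y z) 2 (dom T) :=
  hy.mul' (r := 2) (memLp_top_comp_snd (continuousOn_sqrt_weight hu))

/-- Splitting `u = √u · √u` between the mode and `y` turns a weighted coefficient into an unweighted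
`L²` inner product. -/
lemma modeCoeff_eq_integral_mode (hpos : ∀ x ∈ Icc 0 Real.pi, 0 < u x) (s : Bool) (φ : ℝ → ℝ)
    (m : ℕ) (y : ℝ × ℝ → ℝ) :
    modeCoeff u T s φ m y = ∫ z, mode u T s φ m z * (√(u z.2) * y z) ∂(dom T) := by
  refine integral_congr_ae ?_
  filter_upwards [ae_mem_domain T] with z hz
  have := Real.mul_self_sqrt (hpos z.2 (Ioo_subset_Icc_self hz.2)).le
  simp only [mode]
  linear_combination -(φ z.2 * trig s (2 * Real.pi / T * m * z.1) * y z) * this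

/-- Modes with different labels `(ν, m)` are orthogonal. -/
lemma integral_mode_mul_mode (hT : 0 < T) (hu : ContDiffOn ℝ 2 u (Icc 0 Real.pi))
    (hpos : ∀ x ∈ Icc 0 Real.pi, 0 < u x) {ν₁ ν₂ : ℝ} {φ₁ φ₂ : ℝ → ℝ}
    (h₁ : IsDirichletEigenpair u ν₁ φ₁) (h₂ : IsDirichletEigenpair u ν₂ φ₂) (s r : Bool) (m n : ℕ)
    (hne : (ν₁, m) ≠ (ν₂, n)) :
    ∫ z, mode u T s φ₁ m z * mode u T r φ₂ n z ∂(dom T) = 0 := by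
  have e : ∫ z, mode u T s φ₁ m z * mode u T r φ₂ n z ∂(dom T) =
      ∫ z, (trig s (2 * Real.pi / T * m * z.1) * trig r (2 * Real.pi / T * n * z.1)) *
        (u z.2 * φ₁ z.2 * φ₂ z.2) ∂(dom T) := by
    refine integral_congr_ae ?_
    filter_upwards [ae_mem_domain T] with z hz
    have := Real.mul_self_sqrt (hpos z.2 (Ioo_subset_Icc_self hz.2)).le
    simp only [mode]
    linear_combination (φ₁ z.2 * trig s (2 * Real.pi / T * m * z.1) * (φ₂ z.2 *
      trig r (2 * Real.pi / T * n * z.1))) * this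
  rw [e, dom_eq_prod, integral_prod_mul
    (fun t => trig s (2 * Real.pi / T * m * t) * trig r (2 * Real.pi / T * n * t))
    (fun x => u x * φ₁ x * φ₂ x)]
  rcases eq_or_ne m n with rfl | hmn
  · rw [h₁.integral_mul_eq_zero hu h₂ (fun h => hne (by rw [h])), mul_zero]
  · rw [integral_trig_mul_trig hT hmn, zero_mul]

/-- Completeness of the modes in `L²(Ω)`. -/
theorem ae_eq_zero_of_modeCoeff_eq_zero (hT : 0 < T) (hu : ContDiffOn ℝ 2 u (Icc 0 Real.pi))
    (hpos : ∀ x ∈ Icc 0 Real.pi, 0 < u x) {y : ℝ × ℝ → ℝ} (hy : MemLp y 2 (dom T))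
    (h : ∀ ν φ, IsDirichletEigenpair u ν φ → ∀ s m, modeCoeff u T s φ m y = 0) :
    y =ᵐ[dom T] 0 := by
  obtain ⟨ι, _, ν, φ, heig, htot⟩ := exists_countable_total_eigenpairs hu hpos
  set I := volume.restrict (Ioc 0 T)
  set J := volume.restrict (Ioc 0 Real.pi)
  set Y : ℝ × ℝ → ℝ := fun z => √(u z.2) * y z with hYdef
  have hY : MemLp Y 2 (I.prod J) := dom_eq_prod T ▸ memLp_sqrt_mul hu.continuousOn hy
  have hg (i : ι) : MemLp (fun x => √(u x) * φ i x) 2 J :=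
    memLp_continuousOn 2 ((continuousOn_sqrt_weight hu.continuousOn).mul (heig i).continuousOn)
  -- For a fixed eigenfunction, the coefficient of `Y(t, ·)` is a function of `t` all of whose
  -- trigonometric coefficients vanish.
  have hD (i : ι) : (fun t => ∫ x, (√(u x) * φ i x) * Y (t, x) ∂J) =ᵐ[I] 0 := by
    refine ae_eq_zero_of_integral_trig hT (MemLp.integral_mul_prod hY (hg i)) fun s m => ?_
    have h1 := h (ν i) (φ i) (heig i) s m
    have hint := (memLp_mode (T := T) hu.continuousOn (heig i).continuousOn s m).integrable_mul
      (memLp_sqrt_mul hu.continuousOn hy)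
    rw [modeCoeff_eq_integral_mode hpos, dom_eq_prod, integral_prod _ (dom_eq_prod T ▸ hint)] at h1
    refine Eq.trans (integral_congr_ae (ae_of_all _ fun t => ?_)) h1
    simp only [mode]
    rw [← integral_const_mul]
    refine integral_congr_ae (ae_of_all _ fun x => ?_)
    simp only [hYdef]
    ring
  have hfib : ∀ᵐ t ∂I, ∀ᵐ x ∂J, Y (t, x) = 0 := by
    filter_upwards [ae_all_iff.2 hD, MemLp.ae_memLp_two_prodMk hY] with t h1 h2
    exact htot _ h2 h1
  -- Passing through `∫ Y²` converts vanishing on almost every fibre into vanishing a.e. on `Ω`.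
  have hsq : ∫ z, Y z ^ 2 ∂(I.prod J) = 0 := by
    rw [integral_prod _ hY.integrable_sq]
    refine integral_eq_zero_of_ae ?_
    filter_upwards [hfib] with t ht
    refine integral_eq_zero_of_ae ?_
    filter_upwards [ht] with x hx
    simp [hx]
  rw [integral_eq_zero_iff_of_nonneg (fun _ => sq_nonneg _) hY.integrable_sq, ← dom_eq_prod] at hsq
  filter_upwards [hsq, ae_mem_domain T] with z h1 h2
  have := (Real.sqrt_pos.2 (hpos z.2 (Ioo_subset_Icc_self h2.2))).ne'
  simpa [hYdef, this] using h1

end Modes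

/-! ### Half-period antisymmetry in terms of Fourier coefficients. -/

section HalfShift

variable {u : ℝ → ℝ} {T : ℝ}

lemma exists_dom_eq_add (hT : 0 < T) : ∃ D : Measure (ℝ × ℝ), dom T = dom (T / 2) + D ∧
    MeasurePreserving (fun z : ℝ × ℝ => (z.1 + T / 2, z.2)) (dom (T / 2)) D := by
  refine ⟨(volume.restrict (Ioc (T / 2) T)).prod (volume.restrict (Ioc 0 Real.pi)), ?_, ?_⟩
  · rw [dom_eq_prod, dom_eq_prod, ← Measure.add_prod,
      ← Measure.restrict_union (Ioc_disjoint_Ioc_of_le le_rfl) measurableSet_Ioc,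
      Ioc_union_Ioc_eq_Ioc (by positivity) (by linarith)]
  · rw [dom_eq_prod]
    have h1 := (measurePreserving_add_right volume (T / 2)).restrict_preimage
      (measurableSet_Ioc : MeasurableSet (Ioc (T / 2) T))
    rw [preimage_add_const_Ioc, sub_self, sub_half] at h1
    exact h1.prod (MeasurePreserving.id _)

lemma MemLp.dom_half (hT : 0 < T) {y : ℝ × ℝ → ℝ} {p : ENNReal} (hy : MemLp y p (dom T)) :
    MemLp y p (dom (T / 2)) := by
  obtain ⟨D, hD, -⟩ := exists_dom_eq_add hT
  exact hy.mono_measure (hD ▸ Measure.le_add_right le_rfl)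

lemma MemLp.halfShift (hT : 0 < T) {y : ℝ × ℝ → ℝ} {p : ENNReal} (hy : MemLp y p (dom T)) :
    MemLp (fun z : ℝ × ℝ => y (z.1 + T / 2, z.2)) p (dom (T / 2)) := by
  obtain ⟨D, hD, hmp⟩ := exists_dom_eq_add hT
  exact (hy.mono_measure (hD ▸ Measure.le_add_left le_rfl)).comp_measurePreserving hmp

lemma integral_dom_eq_integral_dom_half (hT : 0 < T) {F : ℝ × ℝ → ℝ} (hF : Integrable F (dom T)) :
    ∫ z, F z ∂(dom T) = ∫ z, (F (z.1 + T / 2, z.2) + F z) ∂(dom (T / 2)) := by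
  rw [← memLp_one_iff_integrable] at hF
  rw [integral_add (memLp_one_iff_integrable.1 (MemLp.halfShift hT hF))
    (memLp_one_iff_integrable.1 (MemLp.dom_half hT hF))]
  obtain ⟨D, hD, hmp⟩ := exists_dom_eq_add hT
  rw [memLp_one_iff_integrable, hD] at hF
  have hemb : MeasurableEmbedding (fun z : ℝ × ℝ => (z.1 + T / 2, z.2)) :=
    (measurableEmbedding_addRight (T / 2)).prodMap MeasurableEmbedding.id
  have h1 := hmp.integral_comp hemb F
  rw [h1, hD, integral_add_measure hF.left_of_add_measure hF.right_of_add_measure, add_comm]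

lemma trig_two_pi_add (s : Bool) (θ : ℝ) (m : ℕ) : trig s (θ + m * (2 * Real.pi)) = trig s θ := by
  cases s
  · exact Real.cos_add_nat_mul_two_pi θ m
  · exact Real.sin_add_nat_mul_two_pi θ m

/-- The coefficients for even `m` only see the half-periodic part of a function. -/
lemma modeCoeff_two_mul (hT : 0 < T) (hu : ContinuousOn u (Icc 0 Real.pi))
    (hpos : ∀ x ∈ Icc 0 Real.pi, 0 < u x) {φ : ℝ → ℝ}
    (hφ : ContinuousOn φ (Icc 0 Real.pi)) (s : Bool) (m : ℕ) {y : ℝ × ℝ → ℝ}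
    (hy : MemLp y 2 (dom T)) :
    modeCoeff u T s φ (2 * m) y =
      modeCoeff u (T / 2) s φ m (fun z => y (z.1 + T / 2, z.2) + y z) := by
  have hint := (memLp_mode (T := T) hu hφ s (2 * m)).integrable_mul (memLp_sqrt_mul hu hy)
  rw [modeCoeff_eq_integral_mode hpos, modeCoeff_eq_integral_mode hpos]
  refine (integral_dom_eq_integral_dom_half hT hint).trans ?_
  refine integral_congr_ae (ae_of_all _ fun z => ?_)
  have e1 : 2 * Real.pi / T * ((2 * m : ℕ) : ℝ) * z.1 = 2 * Real.pi / (T / 2) * m * z.1 := by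
    push_cast; field_simp
  have e2 : 2 * Real.pi / T * ((2 * m : ℕ) : ℝ) * (z.1 + T / 2) =
      2 * Real.pi / (T / 2) * m * z.1 + m * (2 * Real.pi) := by
    push_cast; field_simp
  simp only [mode, Pi.mul_apply, e1, e2, trig_two_pi_add]
  ring

/-- Frequency `2m` for period `T` is frequency `m` for period `T/2`, so the even coefficients of `y`
are the coefficients on the half domain of `y(t + T/2, x) + y(t, x)`. Completeness there shows that
they all vanish exactly when this sum does. -/
lemma halfAntiperiodic_iff (hT : 0 < T) (hu : ContDiffOn ℝ 2 u (Icc 0 Real.pi))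
    (hpos : ∀ x ∈ Icc 0 Real.pi, 0 < u x) {y : ℝ × ℝ → ℝ} (hy : MemLp y 2 (dom T)) :
    HalfAntiperiodic T y ↔ ∀ ν φ, IsDirichletEigenpair u ν φ → ∀ s m, Even m →
      modeCoeff u T s φ m y = 0 := by
  have hsum : HalfAntiperiodic T y ↔
      (fun z => y (z.1 + T / 2, z.2) + y z) =ᵐ[dom (T / 2)] 0 := by
    refine eventually_congr (Eventually.of_forall fun z => ?_)
    rw [Pi.zero_apply, ← eq_neg_iff_add_eq_zero]
  rw [hsum]
  constructor
  · intro h ν φ hφ s m hm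
    obtain ⟨k, rfl⟩ := hm.two_dvd
    rw [modeCoeff_two_mul hT hu.continuousOn hpos hφ.continuousOn s k hy]
    refine integral_eq_zero_of_ae ?_
    filter_upwards [h] with z hz
    rw [hz]
    simp
  · intro h
    refine ae_eq_zero_of_modeCoeff_eq_zero (by positivity) hu hpos
      ((MemLp.halfShift hT hy).add (MemLp.dom_half hT hy)) fun ν φ hφ s m => ?_
    exact (modeCoeff_two_mul hT hu.continuousOn hpos hφ.continuousOn s m hy).symm.trans
      (h ν φ hφ s (2 * m) (even_two_mul m))

end HalfShift

/-! ### Smooth approximation in `C²` with Dirichlet conditions. -/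

section SmoothApproximation

lemma contDiff_infty_primitive {f : ℝ → ℝ} (hf : ContDiff ℝ ∞ f) :
    ContDiff ℝ ∞ fun x => ∫ s in 0..x, f s := by
  rw [contDiff_infty_iff_deriv]
  have hd (x : ℝ) := (hf.continuous.integral_hasStrictDerivAt 0 x).hasDerivAt
  refine ⟨fun x => (hd x).differentiableAt, ?_⟩
  rwa [show (deriv fun x => ∫ s in 0..x, f s) = f from funext fun x => (hd x).deriv]

lemma abs_le_of_hasDerivWithinAt {b C : ℝ} {e e' : ℝ → ℝ}
    (he : ∀ x ∈ Icc 0 b, HasDerivWithinAt e (e' x) (Icc 0 b) x) (h0 : e 0 = 0)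
    (hC : ∀ x ∈ Icc 0 b, |e' x| ≤ C) {x : ℝ} (hx : x ∈ Icc 0 b) : |e x| ≤ C * b := by
  have h0b : (0 : ℝ) ∈ Icc 0 b := ⟨le_rfl, hx.1.trans hx.2⟩
  have h1 := (convex_Icc (0 : ℝ) b).norm_image_sub_le_of_norm_hasDerivWithin_le he hC h0b hx
  rw [h0, sub_zero, sub_zero, Real.norm_eq_abs, Real.norm_of_nonneg hx.1] at h1
  exact h1.trans (mul_le_mul_of_nonneg_left hx.2 ((abs_nonneg _).trans (hC 0 h0b)))

/-- A `C²` function on `[0, b]` vanishing at the end points is approximated in `C²` by smooth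
functions vanishing at the end points. -/
lemma exists_smooth_approx {b : ℝ} (hb : 0 < b) {φ φ₁ φ₂ : ℝ → ℝ}
    (h1 : ∀ x ∈ Icc 0 b, HasDerivWithinAt φ (φ₁ x) (Icc 0 b) x)
    (h2 : ∀ x ∈ Icc 0 b, HasDerivWithinAt φ₁ (φ₂ x) (Icc 0 b) x)
    (hc : ContinuousOn φ₂ (Icc 0 b)) (hl : φ 0 = 0) (hr : φ b = 0) {ε : ℝ} (hε : 0 < ε) :
    ∃ q : ℝ → ℝ, ContDiff ℝ ∞ q ∧ q 0 = 0 ∧ q b = 0 ∧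
      ∀ x ∈ Icc 0 b, |φ x - q x| ≤ ε ∧ |φ₁ x - deriv q x| ≤ ε ∧ |φ₂ x - deriv (deriv q) x| ≤ ε := by
  -- Integrating an error `δ` in the second derivative twice gives `δb` and `δb²`; the linear
  -- correction at most doubles these two.
  set δ := ε / (1 + 2 * b + 2 * b * b) with hδ
  have hδ0 : 0 < δ := by positivity
  have hδe : δ * (1 + 2 * b + 2 * b * b) = ε := by rw [hδ]; field_simp
  obtain ⟨P, hP⟩ := exists_polynomial_near_of_continuousOn 0 b φ₂ hc δ hδ0
  let p₂ : ℝ → ℝ := fun x => P.eval x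
  have hp₂ : ContDiff ℝ ∞ p₂ := by
    simpa [Polynomial.aeval_def] using P.contDiff_aeval (𝕜 := ℝ) ∞
  let p₁ : ℝ → ℝ := fun x => φ₁ 0 + ∫ s in 0..x, p₂ s
  have hp₁ : ContDiff ℝ ∞ p₁ := contDiff_const.add (contDiff_infty_primitive hp₂)
  let p₀ : ℝ → ℝ := fun x => ∫ s in 0..x, p₁ s
  have hp₀ : ContDiff ℝ ∞ p₀ := contDiff_infty_primitive hp₁
  have hd₁ (x : ℝ) : HasDerivAt p₁ (p₂ x) x :=
    (hp₂.continuous.integral_hasStrictDerivAt 0 x).hasDerivAt.const_add _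
  have hd₀ (x : ℝ) : HasDerivAt p₀ (p₁ x) x :=
    (hp₁.continuous.integral_hasStrictDerivAt 0 x).hasDerivAt
  have e2 : ∀ x ∈ Icc 0 b, |p₂ x - φ₂ x| ≤ δ := fun x hx => (hP x hx).le
  have e1 : ∀ x ∈ Icc 0 b, |p₁ x - φ₁ x| ≤ δ * b := fun x hx =>
    abs_le_of_hasDerivWithinAt (e := fun x => p₁ x - φ₁ x)
      (fun x hx => (hd₁ x).hasDerivWithinAt.sub (h2 x hx)) (by simp [p₁]) e2 hx
  have e0 : ∀ x ∈ Icc 0 b, |p₀ x - φ x| ≤ δ * b * b := fun x hx =>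
    abs_le_of_hasDerivWithinAt (e := fun x => p₀ x - φ x)
      (fun x hx => (hd₀ x).hasDerivWithinAt.sub (h1 x hx)) (by simp [p₀, hl]) e1 hx
  -- Subtracting a linear function restores the zero at `b` without changing the second derivative.
  have hdq (x : ℝ) : HasDerivAt (fun x => p₀ x - p₀ b / b * x) (p₁ x - p₀ b / b) x := by
    exact ((hd₀ x).sub ((hasDerivAt_id x).const_mul (p₀ b / b))).congr_deriv (by simp)
  have hdq' : deriv (fun x => p₀ x - p₀ b / b * x) = fun x => p₁ x - p₀ b / b :=
    funext fun x => (hdq x).deriv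
  have hpb : |p₀ b / b| ≤ δ * b := by
    have := e0 b ⟨hb.le, le_rfl⟩
    rw [hr, sub_zero] at this
    rw [abs_div, abs_of_pos hb, div_le_iff₀ hb]
    exact this
  refine ⟨fun x => p₀ x - p₀ b / b * x, hp₀.sub (contDiff_const.mul contDiff_id), by simp [p₀],
    by field_simp; simp, fun x hx => ⟨?_, ?_, ?_⟩⟩
  · have h3 : |p₀ b / b * x| ≤ δ * b * b := by
      rw [abs_mul, abs_of_nonneg hx.1]
      exact mul_le_mul hpb hx.2 hx.1 (by positivity)
    have h4 := e0 x hx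
    rw [abs_le] at *
    have : 0 < δ * b := by positivity
    constructor <;> nlinarith
  · rw [hdq']
    have h4 := e1 x hx
    rw [abs_le] at *
    have : 0 < δ * b * b := by positivity
    constructor <;> nlinarith
  · rw [hdq', deriv_sub_const, (hd₁ x).deriv, abs_sub_comm]
    refine (e2 x hx).trans ?_
    have : 0 < δ * b * b := by positivity
    have : 0 < δ * b := by positivity
    nlinarith

end SmoothApproximation

/-! ### From the weak formulation to Fourier coefficients. -/

section WeakSolution

variable {u : ℝ → ℝ} {T : ℝ}

lemma contDiff_trig (s : Bool) : ContDiff ℝ ∞ (trig s) := by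
  cases s
  · exact Real.contDiff_cos
  · exact Real.contDiff_sin

lemma deriv_deriv_trig (s : Bool) (c w t : ℝ) :
    deriv (fun r => deriv (fun r => c * trig s (w * r)) r) t = -w ^ 2 * (c * trig s (w * t)) := by
  have hw (r : ℝ) : HasDerivAt (fun r => w * r) w r := by
    simpa using (hasDerivAt_id r).const_mul w
  cases s
  · have h1 : (fun r => deriv (fun r => c * trig false (w * r)) r) =
        fun r => c * (-Real.sin (w * r) * w) :=
      funext fun r => ((hw r).cos.const_mul c).deriv
    have h2 : HasDerivAt (fun r => c * (-Real.sin (w * r) * w)) (c * (-(Real.cos (w * t) * w) * w)) t :=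
      ((hw t).sin.neg.mul_const w).const_mul c
    rw [h1, h2.deriv]
    simp only [trig, cond_false]
    ring
  · have h1 : (fun r => deriv (fun r => c * trig true (w * r)) r) =
        fun r => c * (Real.cos (w * r) * w) :=
      funext fun r => ((hw r).sin.const_mul c).deriv
    rw [h1, (((hw t).cos.mul_const w).const_mul c).deriv]
    simp only [trig, cond_true]
    ring

lemma isTestFunction_mul_trig (hT : 0 < T) {q : ℝ → ℝ} (hq : ContDiff ℝ ∞ q) (h0 : q 0 = 0)
    (hpi : q Real.pi = 0) (s : Bool) (m : ℕ) :
    IsTestFunction T fun z => q z.2 * trig s (2 * Real.pi / T * m * z.1) := by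
  have hper (t : ℝ) : trig s (2 * Real.pi / T * m * (t + T)) = trig s (2 * Real.pi / T * m * t) := by
    refine (congrArg (trig s) ?_).trans (trig_two_pi_add s (2 * Real.pi / T * m * t) m)
    field_simp
  refine ⟨(hq.comp contDiff_snd).mul ((contDiff_trig s).comp (contDiff_const.mul contDiff_fst)),
    fun t _ => by simp [h0], fun t _ => by simp [hpi], fun x _ => ?_, fun x _ => ?_⟩
  · have := hper 0
    rw [zero_add] at this
    simp only [this]
  · have h1 := deriv_comp_add_const (fun t => q x * trig s (2 * Real.pi / T * m * t)) T 0
    rw [zero_add] at h1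
    rw [← h1]
    simp only [hper]

lemma waveExpr_mul_trig (hu : ContDiffOn ℝ 2 u (Icc 0 Real.pi)) {q : ℝ → ℝ} (hq : ContDiff ℝ ∞ q)
    (s : Bool) (w : ℝ) {z : ℝ × ℝ} (hz : z.2 ∈ Ioo 0 Real.pi) :
    waveExpr u (fun z => q z.2 * trig s (w * z.1)) z =
      (-w ^ 2 * (u z.2 * q z.2) - (derivWithin u (Icc 0 Real.pi) z.2 * deriv q z.2 +
        u z.2 * deriv (deriv q) z.2)) * trig s (w * z.1) := by
  have hmem : Icc 0 Real.pi ∈ 𝓝 z.2 := Icc_mem_nhds hz.1 hz.2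
  have hud : DifferentiableAt ℝ u z.2 :=
    (hu.differentiableOn (by norm_num) z.2 (Ioo_subset_Icc_self hz)).differentiableAt hmem
  have hq1 : Differentiable ℝ (deriv q) :=
    (contDiff_infty_iff_deriv.1 hq).2.differentiable (by norm_num)
  have h2 : (fun s' => u s' * deriv (fun r => q r * trig s (w * z.1)) s') =
      fun s' => u s' * deriv q s' * trig s (w * z.1) := by
    funext s'
    rw [deriv_mul_const (hq.differentiable (by norm_num) s'), mul_assoc]
  have h3 : HasDerivAt (fun s' => u s' * deriv q s' * trig s (w * z.1))
      ((deriv u z.2 * deriv q z.2 + u z.2 * deriv (deriv q) z.2) * trig s (w * z.1)) z.2 :=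
    (hud.hasDerivAt.mul (hq1 z.2).hasDerivAt).mul_const _
  rw [waveExpr]
  simp only [deriv_deriv_trig]
  rw [h2, h3.deriv, derivWithin_of_mem_nhds hmem]
  ring

lemma integrable_mul_mul_trig {y : ℝ × ℝ → ℝ} (hy : Integrable y (dom T)) {k : ℝ → ℝ}
    (hk : ContinuousOn k (Icc 0 Real.pi)) (s : Bool) (w : ℝ) :
    Integrable (fun z => y z * (k z.2 * trig s (w * z.1))) (dom T) :=
  hy.mul_of_top_left ((memLp_top_trig s w).mul' (r := ⊤) (memLp_top_comp_snd hk))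

/-- Testing a weak solution with (approximate) eigenmodes gives the relation between the Fourier
coefficients. -/
theorem modeCoeff_of_weak (hT : 0 < T) (hu : ContDiffOn ℝ 2 u (Icc 0 Real.pi))
    {y g : ℝ × ℝ → ℝ} (hy : Integrable y (dom T)) (hg : Integrable g (dom T))
    (h : ∀ ψ, IsTestFunction T ψ →
      (∫ z, y z * waveExpr u ψ z ∂(dom T)) - (∫ z, u z.2 * g z * ψ z ∂(dom T)) = 0)
    {ν : ℝ} {φ : ℝ → ℝ} (hφ : IsDirichletEigenpair u ν φ) (s : Bool) (m : ℕ) :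
    modeCoeff u T s φ m g = (ν - (2 * Real.pi / T * m) ^ 2) * modeCoeff u T s φ m y := by
  have hud : UniqueDiffOn ℝ (Icc 0 Real.pi) := uniqueDiffOn_Icc Real.pi_pos
  have hφ2 := hφ.contDiffOn
  rw [show (2 : WithTop ℕ∞) = 1 + 1 by norm_num, contDiffOn_succ_iff_derivWithin hud] at hφ2
  set φ₁ := derivWithin φ (Icc 0 Real.pi) with hφ₁
  have hφ3 := hφ2.2.2
  rw [show (1 : WithTop ℕ∞) = 0 + 1 by norm_num, contDiffOn_succ_iff_derivWithin hud] at hφ3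
  set φ₂ := derivWithin φ₁ (Icc 0 Real.pi) with hφ₂
  have hc₂ : ContinuousOn φ₂ (Icc 0 Real.pi) := hφ3.2.2.continuousOn
  have hu' := hu.of_le (m := 1) (by norm_num)
  rw [show (1 : WithTop ℕ∞) = 0 + 1 by norm_num, contDiffOn_succ_iff_derivWithin hud] at hu'
  set u₁ := derivWithin u (Icc 0 Real.pi) with hu₁
  have hcu₁ : ContinuousOn u₁ (Icc 0 Real.pi) := hu'.2.2.continuousOn
  have hcu := hu.continuousOn
  have heq : ∀ x ∈ Ioo 0 Real.pi, u₁ x * φ₁ x + u x * φ₂ x = -ν * u x * φ x := by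
    intro x hx
    have hmem : Icc 0 Real.pi ∈ 𝓝 x := Icc_mem_nhds hx.1 hx.2
    have hxI := Ioo_subset_Icc_self hx
    have e1 := ((hu'.1 x hxI).hasDerivWithinAt.mul (hφ3.1 x hxI).hasDerivWithinAt).hasDerivAt hmem
    have e2 : (fun s => u s * deriv φ s) =ᶠ[𝓝 x] fun s => u s * φ₁ s := by
      filter_upwards [Ioo_mem_nhds hx.1 hx.2] with s hs
      rw [hφ₁, derivWithin_of_mem_nhds (Icc_mem_nhds hs.1 hs.2)]
    rw [← hφ.eqn x hx, e2.deriv_eq]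
    exact e1.deriv.symm
  set w := 2 * Real.pi / T * m with hw
  obtain ⟨M, hM⟩ := isCompact_Icc.exists_bound_of_continuousOn hcu
  obtain ⟨M₁, hM₁⟩ := isCompact_Icc.exists_bound_of_continuousOn hcu₁
  have hM0 : 0 ≤ M := (norm_nonneg _).trans (hM 0 ⟨le_rfl, Real.pi_pos.le⟩)
  have hM10 : 0 ≤ M₁ := (norm_nonneg _).trans (hM₁ 0 ⟨le_rfl, Real.pi_pos.le⟩)
  -- A constant independent of `ε`: a `C²` error `ε` in the spatial factor changes the tested
  -- identity by at most `ε C`.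
  set C := ∫ z, ((w ^ 2 * M + M₁ + M) * |y z| + M * |g z|) ∂(dom T) with hC
  have hCi : Integrable (fun z => (w ^ 2 * M + M₁ + M) * |y z| + M * |g z|) (dom T) :=
    (hy.abs.const_mul _).add (hg.abs.const_mul _)
  -- the defect, tested with the eigenfunction itself
  set A : ℝ × ℝ → ℝ := fun z =>
    y z * ((-w ^ 2 * (u z.2 * φ z.2) - (u₁ z.2 * φ₁ z.2 + u z.2 * φ₂ z.2)) * trig s (w * z.1)) -
      g z * (u z.2 * φ z.2 * trig s (w * z.1)) with hA
  have hAi1 := integrable_mul_mul_trig hy (k := fun x =>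
    -w ^ 2 * (u x * φ x) - (u₁ x * φ₁ x + u x * φ₂ x))
    ((continuousOn_const.mul (hcu.mul hφ.continuousOn)).sub
      ((hcu₁.mul hφ2.2.2.continuousOn).add (hcu.mul hc₂))) s w
  have hAi2 := integrable_mul_mul_trig hg (k := fun x => u x * φ x) (hcu.mul hφ.continuousOn) s w
  have hAint : ∫ z, A z ∂(dom T) =
      (ν - w ^ 2) * modeCoeff u T s φ m y - modeCoeff u T s φ m g := by
    rw [hA, integral_sub hAi1 hAi2, modeCoeff, modeCoeff, ← integral_const_mul]
    congr 1
    · refine integral_congr_ae ?_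
      filter_upwards [ae_mem_domain T] with z hz
      rw [heq z.2 hz.2]
      ring
    · refine integral_congr_ae (ae_of_all _ fun z => ?_)
      simp only [← hw]
      ring
  -- `φ` is only `C²`, hence not itself admissible. A smooth `q` close to it in `C²` is, and for `q`
  -- the corresponding integral `∫ B` is exactly zero.
  have hbound : ∀ ε > 0, |∫ z, A z ∂(dom T)| ≤ ε * C := by
    intro ε hε
    obtain ⟨q, hq, hq0, hqpi, hqε⟩ := exists_smooth_approx Real.pi_pos
      (fun x hx => (hφ2.1 x hx).hasDerivWithinAt) (fun x hx => (hφ3.1 x hx).hasDerivWithinAt)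
      hc₂ hφ.left hφ.right hε
    have hq1 := (contDiff_infty_iff_deriv.1 hq).2
    have hq2 := (contDiff_infty_iff_deriv.1 hq1).2
    have hB := h _ (isTestFunction_mul_trig hT hq hq0 hqpi s m)
    simp only [← hw] at hB
    set B : ℝ × ℝ → ℝ := fun z =>
      y z * ((-w ^ 2 * (u z.2 * q z.2) - (u₁ z.2 * deriv q z.2 +
        u z.2 * deriv (deriv q) z.2)) * trig s (w * z.1)) -
        g z * (u z.2 * q z.2 * trig s (w * z.1)) with hBdef
    have hBi1 := integrable_mul_mul_trig hy (k := fun x =>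
      -w ^ 2 * (u x * q x) - (u₁ x * deriv q x + u x * deriv (deriv q) x))
      ((continuousOn_const.mul (hcu.mul hq.continuous.continuousOn)).sub
        ((hcu₁.mul hq1.continuous.continuousOn).add (hcu.mul hq2.continuous.continuousOn))) s w
    have hBi2 := integrable_mul_mul_trig hg (k := fun x => u x * q x)
      (hcu.mul hq.continuous.continuousOn) s w
    have hBint : ∫ z, B z ∂(dom T) = 0 := by
      refine Eq.trans ?_ hB
      rw [hBdef, integral_sub hBi1 hBi2]
      congr 1
      · refine integral_congr_ae ?_
        filter_upwards [ae_mem_domain T] with z hz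
        rw [waveExpr_mul_trig hu hq s w hz.2]
      · refine integral_congr_ae (ae_of_all _ fun z => ?_)
        simp only []
        ring
    have hAi : Integrable A (dom T) := hAi1.sub hAi2
    have hBi : Integrable B (dom T) := hBi1.sub hBi2
    rw [← sub_zero (∫ z, A z ∂(dom T)), ← hBint, ← integral_sub hAi hBi, hC,
      ← integral_const_mul, ← Real.norm_eq_abs]
    refine norm_integral_le_of_norm_le (hCi.const_mul ε) ?_
    filter_upwards [ae_mem_domain T] with z hz
    have hzI := Ioo_subset_Icc_self hz.2
    obtain ⟨d0, d1, d2⟩ := hqε z.2 hzI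
    have b0 : |u z.2| ≤ M := hM z.2 hzI
    have b1 : |u₁ z.2| ≤ M₁ := hM₁ z.2 hzI
    have bt := abs_trig_le_one s (w * z.1)
    have e : A z - B z = y z * ((-w ^ 2 * (u z.2 * (φ z.2 - q z.2)) -
        (u₁ z.2 * (φ₁ z.2 - deriv q z.2) + u z.2 * (φ₂ z.2 - deriv (deriv q) z.2))) *
          trig s (w * z.1)) - g z * (u z.2 * (φ z.2 - q z.2) * trig s (w * z.1)) := by
      simp only [hA, hBdef]; ring
    have f0 : |u z.2 * (φ z.2 - q z.2)| ≤ M * ε := by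
      rw [abs_mul]; exact mul_le_mul b0 d0 (abs_nonneg _) hM0
    have f1 : |u₁ z.2 * (φ₁ z.2 - deriv q z.2)| ≤ M₁ * ε := by
      rw [abs_mul]; exact mul_le_mul b1 d1 (abs_nonneg _) hM10
    have f2 : |u z.2 * (φ₂ z.2 - deriv (deriv q) z.2)| ≤ M * ε := by
      rw [abs_mul]; exact mul_le_mul b0 d2 (abs_nonneg _) hM0
    have f3 : |-w ^ 2 * (u z.2 * (φ z.2 - q z.2)) -
        (u₁ z.2 * (φ₁ z.2 - deriv q z.2) + u z.2 * (φ₂ z.2 - deriv (deriv q) z.2))| ≤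
        (w ^ 2 * M + M₁ + M) * ε := by
      refine (abs_sub _ _).trans ?_
      have g1 := abs_add_le (u₁ z.2 * (φ₁ z.2 - deriv q z.2))
        (u z.2 * (φ₂ z.2 - deriv (deriv q) z.2))
      have g2 : |-w ^ 2 * (u z.2 * (φ z.2 - q z.2))| ≤ w ^ 2 * (M * ε) := by
        rw [abs_mul, abs_neg, abs_of_nonneg (sq_nonneg w)]
        exact mul_le_mul_of_nonneg_left f0 (sq_nonneg w)
      linarith
    change |A z - B z| ≤ _
    rw [e]
    refine (abs_sub _ _).trans ?_
    rw [abs_mul, abs_mul, abs_mul, abs_mul (u z.2 * _)]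
    have k1 := mul_le_mul f3 bt (abs_nonneg _) (by positivity)
    have k2 := mul_le_mul f0 bt (abs_nonneg _) (by positivity)
    have k3 := mul_le_mul_of_nonneg_left k1 (abs_nonneg (y z))
    have k4 := mul_le_mul_of_nonneg_left k2 (abs_nonneg (g z))
    linarith
  have hzero : ∫ z, A z ∂(dom T) = 0 := by
    have hlim : Tendsto (fun ε : ℝ => ε * C) (𝓝[>] 0) (𝓝 0) := by
      have : Continuous fun ε : ℝ => ε * C := by fun_prop
      simpa using (this.tendsto 0).mono_left nhdsWithin_le_nhds
    have := ge_of_tendsto hlim (eventually_nhdsWithin_of_forall fun ε hε => hbound ε hε)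
    exact abs_nonpos_iff.1 this
  linarith [hAint, hzero]

end WeakSolution

/-! ### Hilbert space: bases adapted to labels, diagonal forms, spectral splitting. -/

section LabelledBasis

variable {H : Type} [NormedAddCommGroup H] [InnerProductSpace ℝ H]

lemma inner_starProjection_of_mem (V : Submodule ℝ H) [V.HasOrthogonalProjection] {v : H}
    (hv : v ∈ V) (x : H) : inner ℝ v (V.starProjection x) = inner ℝ v x := by
  have := V.sub_starProjection_mem_orthogonal x v hv
  rw [inner_sub_right, sub_eq_zero] at this
  exact this.symm

lemma HilbertBasis.eq_zero_of_inner_eq_zero {κ : Type*} (b : HilbertBasis κ ℝ H) {x : H}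
    (h : ∀ a, inner ℝ (b a) x = 0) : x = 0 := by
  rw [← inner_self_eq_zero (𝕜 := ℝ)]
  refine (b.hasSum_inner_mul_inner x x).unique ?_
  simp only [h, mul_zero]
  exact hasSum_zero

/-- A total family whose members with different labels are orthogonal yields a Hilbert basis
adapted to the decomposition by labels. -/
theorem exists_hilbertBasis_of_labelled [CompleteSpace H] {ι L : Type} (e : ι → H) (l : ι → L)
    (hort : ∀ i j, l i ≠ l j → inner ℝ (e i) (e j) = 0)
    (htot : ∀ x, (∀ i, inner ℝ (e i) x = 0) → x = 0) :
    ∃ (κ : Type) (b : HilbertBasis κ ℝ H) (k : κ → L),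
      ∀ a x, (∀ i, l i = k a → inner ℝ (e i) x = 0) → inner ℝ (b a) x = 0 := by
  classical
  let S : L → Submodule ℝ H := fun r => Submodule.span ℝ (e '' {i | l i = r})
  let V : L → Submodule ℝ H := fun r => (S r).topologicalClosure
  have hVc (r : L) : CompleteSpace (V r) :=
    (S r).isClosed_topologicalClosure.completeSpace_coe
  have hVx (r : L) (x : H) (hx : ∀ i, l i = r → inner ℝ (e i) x = 0) :
      ∀ v ∈ V r, inner ℝ v x = 0 := by
    have : V r ≤ (ℝ ∙ x)ᗮ := by
      refine Submodule.topologicalClosure_minimal _ ?_ (Submodule.isClosed_orthogonal _)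
      rw [Submodule.span_le]
      rintro _ ⟨i, hi, rfl⟩
      exact Submodule.mem_orthogonal_singleton_iff_inner_left.2 (hx i hi)
    exact fun v hv => Submodule.mem_orthogonal_singleton_iff_inner_left.1 (this hv)
  have heV (i : ι) : e i ∈ V (l i) :=
    Submodule.le_topologicalClosure _ (Submodule.subset_span ⟨i, rfl, rfl⟩)
  have hfam : OrthogonalFamily ℝ (fun r => V r) fun r => (V r).subtypeₗᵢ := by
    intro r r' hr v v'
    refine hVx r _ (fun i hi => ?_) v v.2
    rw [real_inner_comm]
    refine hVx r' _ (fun j hj => ?_) v' v'.2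
    exact hort j i (by rw [hi, hj]; exact hr.symm)
  choose w B hB using fun r => exists_hilbertBasis ℝ (V r)
  have hon : Orthonormal ℝ fun a : Σ r, w r => (V a.1).subtypeₗᵢ (B a.1 a.2) :=
    hfam.orthonormal_sigma_orthonormal fun r => (B r).orthonormal
  have hbot : (Submodule.span ℝ (range fun a : Σ r, w r => (V a.1).subtypeₗᵢ (B a.1 a.2)))ᗮ = ⊥ := by
    rw [Submodule.eq_bot_iff]
    intro x hx
    -- A vector orthogonal to all chosen basis vectors has zero projection on each `V (l i)`, so it
    -- is orthogonal to every `e i`, and totality applies.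
    refine htot x fun i => ?_
    have hproj : (⟨_, (V (l i)).starProjection_apply_mem x⟩ : V (l i)) = 0 := by
      refine HilbertBasis.eq_zero_of_inner_eq_zero (B (l i)) fun a => ?_
      rw [Submodule.coe_inner, inner_starProjection_of_mem _ (SetLike.coe_mem _)]
      exact hx _ (Submodule.subset_span ⟨⟨l i, a⟩, rfl⟩)
    have hzero : (V (l i)).starProjection x = 0 := congrArg Subtype.val hproj
    rw [← inner_starProjection_of_mem _ (heV i), hzero, inner_zero_right]
  refine ⟨_, HilbertBasis.mkOfOrthogonalEqBot hon hbot, fun a => a.1, fun a x hx => ?_⟩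
  rw [HilbertBasis.coe_mkOfOrthogonalEqBot]
  exact hVx a.1 x hx _ (SetLike.coe_mem _)

/-- The part of a vector supported on a subset of a Hilbert basis. -/
lemma exists_part [CompleteSpace H] {κ : Type*} (b : HilbertBasis κ ℝ H) (A : Set κ) (y : H) :
    ∃ w : H, (∀ a ∈ A, inner ℝ (b a) w = inner ℝ (b a) y) ∧ ∀ a ∉ A, inner ℝ (b a) w = 0 := by
  let V : Submodule ℝ H := (Submodule.span ℝ (b '' A)).topologicalClosure
  have : CompleteSpace V := (Submodule.isClosed_topologicalClosure _).completeSpace_coe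
  refine ⟨V.starProjection y, fun a ha => ?_, fun a ha => ?_⟩
  · exact inner_starProjection_of_mem V
      (Submodule.le_topologicalClosure _ (Submodule.subset_span ⟨a, ha, rfl⟩)) _
  · have hle : V ≤ (ℝ ∙ b a)ᗮ := by
      refine Submodule.topologicalClosure_minimal _ ?_ (Submodule.isClosed_orthogonal _)
      rw [Submodule.span_le]
      rintro _ ⟨c, hc, rfl⟩
      refine Submodule.mem_orthogonal_singleton_iff_inner_right.2 (b.orthonormal.2 ?_)
      rintro rfl
      exact ha hc
    exact Submodule.mem_orthogonal_singleton_iff_inner_right.1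
      (hle (Submodule.starProjection_apply_mem _ _))

/-- Lower bound for the quadratic form of a diagonal operator, with the case of equality. -/
lemma le_inner_of_coeff {κ : Type*} (b : HilbertBasis κ ℝ H) {μ : κ → ℝ} {c : ℝ} {g w : H}
    (h : ∀ a, inner ℝ (b a) w ≠ 0 → inner ℝ (b a) g = μ a * inner ℝ (b a) w ∧ c ≤ μ a) :
    c * inner ℝ w w ≤ inner ℝ g w ∧
      (inner ℝ g w ≤ c * inner ℝ w w → ∀ a, inner ℝ (b a) w ≠ 0 → μ a = c) := by
  -- By Parseval, `⟨g, w⟩ - c ‖w‖²` is the sum of the nonnegative terms `(μ a - c) ⟨b a, w⟩²`; it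
  -- vanishes only if each term does.
  have h1 := (b.hasSum_inner_mul_inner g w).sub ((b.hasSum_inner_mul_inner w w).mul_left c)
  have h2 (a : κ) : inner ℝ g (b a) * inner ℝ (b a) w - c * (inner ℝ w (b a) * inner ℝ (b a) w) =
      (μ a - c) * inner ℝ (b a) w ^ 2 := by
    rw [real_inner_comm (b a) g, real_inner_comm (b a) w]
    by_cases hw : inner ℝ (b a) w = 0
    · simp [hw]
    · rw [(h a hw).1]; ring
  have h3 (a : κ) : 0 ≤ (μ a - c) * inner ℝ (b a) w ^ 2 := by
    by_cases hw : inner ℝ (b a) w = 0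
    · simp [hw]
    · exact mul_nonneg (sub_nonneg.2 (h a hw).2) (sq_nonneg _)
  simp only [h2] at h1
  have h4 := h1.nonneg h3
  refine ⟨sub_nonneg.1 h4, fun hle a ha => ?_⟩
  have h5 : inner ℝ g w - c * inner ℝ w w = 0 := le_antisymm (sub_nonpos.2 hle) h4
  rw [h5] at h1
  have h6 := congrFun ((hasSum_zero_iff_of_nonneg h3).1 h1) a
  rcases mul_eq_zero.1 h6 with h7 | h7
  · exact sub_eq_zero.1 h7
  · exact absurd (pow_eq_zero_iff (two_ne_zero) |>.1 h7) ha

/-- Splitting a vector along a spectral gap. -/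
theorem exists_split_of_gap [CompleteSpace H] {κ : Type*} (b : HilbertBasis κ ℝ H) {μ : κ → ℝ} {c₁ c₂ : ℝ}
    (hc : c₁ < c₂) {y g : H} (hg : ∀ a, inner ℝ (b a) g = μ a * inner ℝ (b a) y)
    (hgap : ∀ a, inner ℝ (b a) y ≠ 0 → μ a ≤ c₁ ∨ c₂ ≤ μ a) :
    ∃ v w : H, y = v + w ∧
      (∀ a, inner ℝ (b a) v ≠ 0 → inner ℝ (b a) y ≠ 0) ∧
      (∀ a, inner ℝ (b a) w ≠ 0 → inner ℝ (b a) y ≠ 0) ∧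
      inner ℝ g v ≤ c₁ * inner ℝ v v ∧ c₂ * inner ℝ w w ≤ inner ℝ g w ∧
      (c₁ * inner ℝ v v ≤ inner ℝ g v → ∀ a, inner ℝ (b a) v ≠ 0 → μ a = c₁) ∧
      (inner ℝ g w ≤ c₂ * inner ℝ w w → ∀ a, inner ℝ (b a) w ≠ 0 → μ a = c₂) := by
  obtain ⟨v, hv1, hv2⟩ := exists_part b {a | μ a ≤ c₁} y
  obtain ⟨w, hw1, hw2⟩ := exists_part b {a | c₂ ≤ μ a} y
  have hv3 (a : κ) (ha : inner ℝ (b a) v ≠ 0) : μ a ≤ c₁ := by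
    by_contra h
    exact ha (hv2 a h)
  have hw3 (a : κ) (ha : inner ℝ (b a) w ≠ 0) : c₂ ≤ μ a := by
    by_contra h
    exact ha (hw2 a h)
  -- The upper bound on the low part is the lower bound for `-μ` and `-g`.
  have hV := le_inner_of_coeff b (μ := fun a => -μ a) (c := -c₁) (g := -g) (w := v)
    fun a ha => ⟨by rw [inner_neg_right, hg, hv1 a (hv3 a ha)]; ring, neg_le_neg (hv3 a ha)⟩
  have hW := le_inner_of_coeff b (μ := μ) (c := c₂) (g := g) (w := w)
    fun a ha => ⟨by rw [hg, hw1 a (hw3 a ha)], hw3 a ha⟩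
  rw [inner_neg_left] at hV
  refine ⟨v, w, ?_, fun a ha => hv1 a (hv3 a ha) ▸ ha, fun a ha => hw1 a (hw3 a ha) ▸ ha,
    by linarith [hV.1], hW.1, fun h a ha => neg_injective (hV.2 (by linarith) a ha), hW.2⟩
  rw [← sub_eq_zero]
  refine HilbertBasis.eq_zero_of_inner_eq_zero b fun a => ?_
  rw [inner_sub_right, inner_add_right]
  by_cases h1 : μ a ≤ c₁
  · rw [hv1 a h1, hw2 a (show ¬ c₂ ≤ μ a by linarith)]
    ring
  · by_cases h2 : c₂ ≤ μ a
    · rw [hv2 a h1, hw1 a h2]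
      ring
    · rw [hv2 a h1, hw2 a h2]
      by_contra h
      exact (hgap a fun h0 => h (by rw [h0]; ring)).elim h1 h2

end LabelledBasis

/-! ### The wave operator on an adapted basis and linear uniqueness. -/

section WaveOperator

variable {u : ℝ → ℝ} {T : ℝ}

/-- The isometry `y ↦ √u y` from the weighted space to `L²(dt dx)`, on representatives. -/
noncomputable def toL2 (hu : ContinuousOn u (Icc 0 Real.pi)) {y : ℝ × ℝ → ℝ}
    (hy : MemLp y 2 (dom T)) : Lp ℝ 2 (dom T) :=
  (memLp_sqrt_mul hu hy).toLp

lemma toL2_ae (hu : ContinuousOn u (Icc 0 Real.pi)) {y : ℝ × ℝ → ℝ}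
    (hy : MemLp y 2 (dom T)) : toL2 hu hy =ᵐ[dom T] fun z => √(u z.2) * y z :=
  (memLp_sqrt_mul hu hy).coeFn_toLp

/-- The inverse `x ↦ x / √u` of the isometry `toL2`. -/
noncomputable def ofL2 (u : ℝ → ℝ) (x : Lp ℝ 2 (dom T)) (z : ℝ × ℝ) : ℝ := (√(u z.2))⁻¹ * x z

lemma memLp_ofL2 (hu : ContinuousOn u (Icc 0 Real.pi)) (hpos : ∀ x ∈ Icc 0 Real.pi, 0 < u x)
    (x : Lp ℝ 2 (dom T)) : MemLp (ofL2 u x) 2 (dom T) :=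
  (Lp.memLp x).mul' (r := 2) (memLp_top_comp_snd (continuousOn_inv_sqrt_weight hu hpos))

lemma toL2_ofL2 (hu : ContinuousOn u (Icc 0 Real.pi)) (hpos : ∀ x ∈ Icc 0 Real.pi, 0 < u x)
    (x : Lp ℝ 2 (dom T)) : toL2 hu (memLp_ofL2 hu hpos x) = x := by
  refine Lp.ext ?_
  filter_upwards [toL2_ae hu (memLp_ofL2 hu hpos x), ae_mem_domain T] with z h1 h2
  rw [h1, ofL2]
  exact mul_inv_cancel_left₀ (Real.sqrt_pos.2 (hpos z.2 (Ioo_subset_Icc_self h2.2))).ne' _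

lemma eq_zero_of_ofL2_ae (hu : ContinuousOn u (Icc 0 Real.pi))
    (hpos : ∀ x ∈ Icc 0 Real.pi, 0 < u x) (x : Lp ℝ 2 (dom T)) (h : ofL2 u x =ᵐ[dom T] 0) :
    x = 0 := by
  rw [← toL2_ofL2 hu hpos x]
  refine Lp.ext ?_
  filter_upwards [toL2_ae hu (memLp_ofL2 hu hpos x), h, Lp.coeFn_zero ℝ 2 (dom T)] with z h1 h2 h3
  rw [h1, h2, h3, Pi.zero_apply, mul_zero]

/-- The indices of the modes: an eigenpair, the choice of `sin` or `cos`, and the frequency. -/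
abbrev ModeIndex (u : ℝ → ℝ) : Type :=
  {p : ℝ × (ℝ → ℝ) // IsDirichletEigenpair u p.1 p.2} × Bool × ℕ

/-- The modes as elements of `L²`. -/
noncomputable def modeL2 (hu : ContinuousOn u (Icc 0 Real.pi)) (T : ℝ) (i : ModeIndex u) :
    Lp ℝ 2 (dom T) :=
  (memLp_mode (T := T) hu i.1.2.continuousOn i.2.1 i.2.2).toLp

/-- The label `(ν, m)` of a mode. -/
def modeLabel (i : ModeIndex u) : ℝ × ℕ := (i.1.1.1, i.2.2)

/-- The eigenvalue `ν - (2πm/T)²` of the wave operator for the label `(ν, m)`. -/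
noncomputable def waveEigenvalue (T : ℝ) (r : ℝ × ℕ) : ℝ := r.1 - (2 * Real.pi / T * r.2) ^ 2

lemma inner_modeL2_toL2 (hu : ContinuousOn u (Icc 0 Real.pi))
    (hpos : ∀ x ∈ Icc 0 Real.pi, 0 < u x) (i : ModeIndex u) {y : ℝ × ℝ → ℝ}
    (hy : MemLp y 2 (dom T)) :
    inner ℝ (modeL2 hu T i) (toL2 hu hy) = modeCoeff u T i.2.1 i.1.1.2 i.2.2 y := by
  rw [modeL2, toL2, inner_toLp_toLp, modeCoeff_eq_integral_mode hpos]

lemma inner_modeL2_eq_modeCoeff_ofL2 (hu : ContinuousOn u (Icc 0 Real.pi))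
    (hpos : ∀ x ∈ Icc 0 Real.pi, 0 < u x) (i : ModeIndex u) (x : Lp ℝ 2 (dom T)) :
    inner ℝ (modeL2 hu T i) x = modeCoeff u T i.2.1 i.1.1.2 i.2.2 (ofL2 u x) := by
  rw [← inner_modeL2_toL2 hu hpos i (memLp_ofL2 hu hpos x), toL2_ofL2 hu hpos]

/-- A Hilbert basis of `L²` adapted to the labels of the modes. -/
theorem exists_adapted_basis (hT : 0 < T) (hu : ContDiffOn ℝ 2 u (Icc 0 Real.pi))
    (hpos : ∀ x ∈ Icc 0 Real.pi, 0 < u x) :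
    ∃ (κ : Type) (b : HilbertBasis κ ℝ (Lp ℝ 2 (dom T))) (k : κ → ℝ × ℕ),
      (∀ a x, (∀ i, modeLabel i = k a → inner ℝ (modeL2 hu.continuousOn T i) x = 0) →
        inner ℝ (b a) x = 0) ∧
      ∀ a i, modeLabel i ≠ k a → inner ℝ (modeL2 hu.continuousOn T i) (b a) = 0 := by
  have hort (i j : ModeIndex u) (hij : modeLabel i ≠ modeLabel j) :
      inner ℝ (modeL2 hu.continuousOn T i) (modeL2 hu.continuousOn T j) = 0 := by
    rw [modeL2, modeL2, inner_toLp_toLp]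
    exact integral_mode_mul_mode hT hu hpos i.1.2 j.1.2 _ _ _ _ hij
  obtain ⟨κ, b, k, hb⟩ := exists_hilbertBasis_of_labelled (modeL2 hu.continuousOn T) modeLabel hort
    fun x hx => eq_zero_of_ofL2_ae hu.continuousOn hpos x
      (ae_eq_zero_of_modeCoeff_eq_zero hT hu hpos (memLp_ofL2 hu.continuousOn hpos x)
        fun ν φ h s m => (inner_modeL2_eq_modeCoeff_ofL2 hu.continuousOn hpos
          (⟨⟨(ν, φ), h⟩, s, m⟩ : ModeIndex u) x).symm.trans (hx _))
  -- The first property applies to the mode `i` itself, which is orthogonal to every mode labelled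
  -- `k a`.
  refine ⟨κ, b, k, hb, fun a i hi => ?_⟩
  rw [real_inner_comm]
  exact hb a _ fun j hj => hort j i (by rw [hj]; exact hi.symm)

/-- A vector supported on basis elements with odd frequency and eigenvalue `c` belongs to
`ker (L_o - c)`. -/
lemma memKerLo_ofL2 (hT : 0 < T) (hu : ContDiffOn ℝ 2 u (Icc 0 Real.pi))
    (hpos : ∀ x ∈ Icc 0 Real.pi, 0 < u x) {κ : Type} (b : HilbertBasis κ ℝ (Lp ℝ 2 (dom T)))
    {k : κ → ℝ × ℕ}
    (hb : ∀ a i, modeLabel i ≠ k a → inner ℝ (modeL2 hu.continuousOn T i) (b a) = 0)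
    {c : ℝ} {x : Lp ℝ 2 (dom T)}
    (hx : ∀ a, inner ℝ (b a) x ≠ 0 → ¬ Even (k a).2 ∧ waveEigenvalue T (k a) = c) :
    MemKerLo u T c (ofL2 u x) := by
  have hmem := memLp_ofL2 hu.continuousOn hpos x
  -- Expand the coefficient in the basis: a surviving term would need `b a` to carry the label of
  -- `i`, which `hx` then forces to have odd frequency and eigenvalue `c`.
  have key (i : ModeIndex u) (hi : Even (modeLabel i).2 ∨ waveEigenvalue T (modeLabel i) ≠ c) :
      modeCoeff u T i.2.1 i.1.1.2 i.2.2 (ofL2 u x) = 0 := by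
    rw [← inner_modeL2_eq_modeCoeff_ofL2 hu.continuousOn hpos]
    refine (b.hasSum_inner_mul_inner (modeL2 hu.continuousOn T i) x).unique ?_
    convert hasSum_zero using 2 with a
    by_cases ha : inner ℝ (b a) x = 0
    · rw [ha, mul_zero]
    · obtain ⟨h1, h2⟩ := hx a ha
      rw [hb a i, zero_mul]
      intro h
      rw [h] at hi
      exact hi.elim h1 fun h' => h' h2
  refine ⟨⟨(memL2_iff_memLp hu.continuousOn hpos _).2 hmem, ?_⟩, ?_⟩
  · rw [halfAntiperiodic_iff hT hu hpos hmem]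
    exact fun ν φ h s m hm => key ⟨⟨(ν, φ), h⟩, s, m⟩ (Or.inl hm)
  · rw [waveOp_iff hu.continuousOn hpos]
    refine ⟨hmem, hmem.const_mul c, fun ν φ h s m => ?_⟩
    have e : modeCoeff u T s φ m (fun z => c * ofL2 u x z) = c * modeCoeff u T s φ m (ofL2 u x) := by
      rw [modeCoeff, modeCoeff, ← integral_const_mul]
      refine integral_congr_ae (ae_of_all _ fun z => ?_)
      ring
    rw [e]
    by_cases hc : waveEigenvalue T (ν, m) = c
    · rw [← hc]
      rfl
    · rw [key ⟨⟨(ν, φ), h⟩, s, m⟩ (Or.inr hc), mul_zero, mul_zero]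

/-- Uniqueness for the linear equation `L y = g` with `g = a y`, `α ≤ a ≤ β`, in `M_o`. -/
theorem ae_eq_zero_of_nonresonance (hT : 0 < T) (hu : ContDiffOn ℝ 2 u (Icc 0 Real.pi))
    (hpos : ∀ x ∈ Icc 0 Real.pi, 0 < u x) {c₁ c₂ : ℝ}
    (hc : Consecutive (eigenvaluesLo u T) c₁ c₂) {α β : ℝ × ℝ → ℝ}
    (hαβ : ∀ᵐ z ∂(dom T), c₁ ≤ α z ∧ α z ≤ β z ∧ β z ≤ c₂)
    (hα : ∀ v, MemKerLo u T c₁ v → ¬ v =ᵐ[dom T] 0 → 0 < ∫ z, (α z - c₁) * v z ^ 2 ∂(dom T))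
    (hβ : ∀ w, MemKerLo u T c₂ w → ¬ w =ᵐ[dom T] 0 → 0 < ∫ z, (c₂ - β z) * w z ^ 2 ∂(dom T))
    {y g : ℝ × ℝ → ℝ} (hy : MemMo u T y) (hL : WaveOp u T y g)
    (hg : ∀ᵐ z ∂(dom T), ∃ a, α z ≤ a ∧ a ≤ β z ∧ g z = a * y z) :
    y =ᵐ[dom T] 0 := by
  have huc := hu.continuousOn
  obtain ⟨hym, hgm, hcoef⟩ := (waveOp_iff huc hpos y g).1 hL
  have hodd := (halfAntiperiodic_iff hT hu hpos hym).1 hy.2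
  obtain ⟨κ, b, k, hb, hb'⟩ := exists_adapted_basis hT hu hpos
  set Y := toL2 huc hym with hY
  set G := toL2 huc hgm with hG
  have hGY (a : κ) : inner ℝ (b a) G = waveEigenvalue T (k a) * inner ℝ (b a) Y := by
    rw [← sub_eq_zero, ← real_inner_smul_right, ← inner_sub_right]
    refine hb a _ fun i hi => ?_
    rw [inner_sub_right, inner_smul_right, hG, hY, inner_modeL2_toL2 huc hpos,
      inner_modeL2_toL2 huc hpos, hcoef _ _ i.1.2, ← hi, sub_eq_zero]
    rfl
  have hYodd (a : κ) (ha : inner ℝ (b a) Y ≠ 0) : ¬ Even (k a).2 := by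
    intro heven
    refine ha (hb a _ fun i hi => ?_)
    rw [hY, inner_modeL2_toL2 huc hpos]
    refine hodd _ _ i.1.2 _ _ ?_
    rw [← hi] at heven
    exact heven
  have hgap (a : κ) (ha : inner ℝ (b a) Y ≠ 0) :
      waveEigenvalue T (k a) ≤ c₁ ∨ c₂ ≤ waveEigenvalue T (k a) := by
    -- The basis vector `b a` is itself an eigenvector of `L_o`, so its eigenvalue cannot lie
    -- strictly between consecutive ones.
    have hmem : waveEigenvalue T (k a) ∈ eigenvaluesLo u T := by
      refine ⟨ofL2 u (b a), memKerLo_ofL2 hT hu hpos b hb' fun a' ha' => ?_, fun h0 => ?_⟩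
      · have : a' = a := by
          by_contra hne
          exact ha' (b.orthonormal.2 hne)
        rw [this]
        exact ⟨hYodd a ha, rfl⟩
      · exact b.orthonormal.ne_zero a (eq_zero_of_ofL2_ae huc hpos _ h0)
    have := hc.2.2.2 _ hmem
    by_contra! h
    exact this h
  obtain ⟨v, w, hvw, hvY, hwY, hv, hw, hv', hw'⟩ := exists_split_of_gap b hc.2.2.1 hGY hgap
  -- pointwise form of the defect
  have hpt : ∀ᵐ z ∂(dom T), 0 ≤ α z - c₁ ∧ 0 ≤ c₂ - β z ∧
      (α z - c₁) * v z ^ 2 + (c₂ - β z) * w z ^ 2 ≤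
        G z * v z - c₁ * v z ^ 2 + (c₂ * w z ^ 2 - G z * w z) := by
    filter_upwards [toL2_ae huc hym, toL2_ae huc hgm, hg, hαβ, Lp.coeFn_add v w]
      with z e1 e2 ⟨a, ha1, ha2, ha3⟩ e4 e5
    have e6 : G z = a * (v z + w z) := by
      rw [hG, e2, ha3, mul_left_comm, ← e1, ← hY, hvw, e5, Pi.add_apply]
    refine ⟨by linarith, by linarith, ?_⟩
    rw [e6]
    -- With `G = a (v + w)`, `G v - G w = a (v² - w²)`, so the right side is exactly `(a - c₁) v² +
    -- (c₂ - a) w²`.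
    nlinarith [mul_nonneg (sub_nonneg.2 ha1) (sq_nonneg (v z)),
      mul_nonneg (sub_nonneg.2 ha2) (sq_nonneg (w z))]
  have hinner (p r : Lp ℝ 2 (dom T)) : inner ℝ p r = ∫ z, p z * r z ∂(dom T) := by
    rw [L2.inner_def]
    refine integral_congr_ae (ae_of_all _ fun z => ?_)
    simp [mul_comm]
  have hint (p r : Lp ℝ 2 (dom T)) : Integrable (fun z => p z * r z) (dom T) :=
    (Lp.memLp p).integrable_mul (Lp.memLp r)
  set D : ℝ × ℝ → ℝ := fun z =>
    G z * v z - c₁ * v z ^ 2 + (c₂ * w z ^ 2 - G z * w z) with hD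
  have hDi : Integrable D (dom T) := by
    simp only [hD, pow_two]
    exact ((hint G v).sub ((hint v v).const_mul c₁)).add
      (((hint w w).const_mul c₂).sub (hint G w))
  have hDint : ∫ z, D z ∂(dom T) =
      inner ℝ G v - c₁ * inner ℝ v v + (c₂ * inner ℝ w w - inner ℝ G w) := by
    have h1 : Integrable (fun z => G z * v z - c₁ * (v z * v z)) (dom T) :=
      (hint G v).sub ((hint v v).const_mul c₁)
    have h2 : Integrable (fun z => c₂ * (w z * w z) - G z * w z) (dom T) :=
      ((hint w w).const_mul c₂).sub (hint G w)
    simp only [hD, pow_two, hinner]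
    rw [integral_add h1 h2, integral_sub (hint G v) ((hint v v).const_mul c₁),
      integral_sub ((hint w w).const_mul c₂) (hint G w), integral_const_mul, integral_const_mul]
  have hD0 : 0 ≤ᵐ[dom T] D := by
    filter_upwards [hpt] with z ⟨h1, h2, h3⟩
    exact le_trans (by positivity) h3
  -- The spectral inequalities for `v` and `w` give the opposite sign, so `D = 0` a.e. and both
  -- inequalities are equalities.
  have hDle : ∫ z, D z ∂(dom T) ≤ 0 := by rw [hDint]; linarith
  have hDeq : ∫ z, D z ∂(dom T) = 0 := le_antisymm hDle (integral_nonneg_of_ae hD0)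
  have hDae := (integral_eq_zero_iff_of_nonneg_ae hD0 hDi).1 hDeq
  have hvz : v = 0 := by
    refine eq_zero_of_ofL2_ae huc hpos v ?_
    by_contra hne
    have hker : MemKerLo u T c₁ (ofL2 u v) := memKerLo_ofL2 hT hu hpos b hb' fun a ha =>
      ⟨hYodd a (hvY a ha), hv' (by linarith) a ha⟩
    refine (hα _ hker hne).ne' (integral_eq_zero_of_ae ?_)
    filter_upwards [hpt, hDae] with z ⟨h1, h2, h3⟩ h4
    have h5 : (α z - c₁) * v z ^ 2 = 0 := by
      have h6 := mul_nonneg h1 (sq_nonneg (v z))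
      have h7 := mul_nonneg h2 (sq_nonneg (w z))
      simp only [Pi.zero_apply, hD] at h4
      linarith
    -- Undoing the `√u` substitution only multiplies the vanishing integrand by `1/u`.
    simp only [ofL2, Pi.zero_apply]
    linear_combination (√(u z.2))⁻¹ ^ 2 * h5
  have hwz : w = 0 := by
    refine eq_zero_of_ofL2_ae huc hpos w ?_
    by_contra hne
    have hker : MemKerLo u T c₂ (ofL2 u w) := memKerLo_ofL2 hT hu hpos b hb' fun a ha =>
      ⟨hYodd a (hwY a ha), hw' (by linarith) a ha⟩
    refine (hβ _ hker hne).ne' (integral_eq_zero_of_ae ?_)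
    filter_upwards [hpt, hDae] with z ⟨h1, h2, h3⟩ h4
    have h5 : (c₂ - β z) * w z ^ 2 = 0 := by
      have h6 := mul_nonneg h1 (sq_nonneg (v z))
      have h7 := mul_nonneg h2 (sq_nonneg (w z))
      simp only [Pi.zero_apply, hD] at h4
      linarith
    simp only [ofL2, Pi.zero_apply]
    linear_combination (√(u z.2))⁻¹ ^ 2 * h5
  have hYz : Y = 0 := by rw [hvw, hvz, hwz, add_zero]
  filter_upwards [toL2_ae huc hym, Lp.coeFn_zero ℝ 2 (dom T), ae_mem_domain T] with z e1 e2 e3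
  rw [← hY, hYz, e2, Pi.zero_apply, eq_comm] at e1
  exact (mul_eq_zero.1 e1).resolve_left
    (Real.sqrt_pos.2 (hpos z.2 (Ioo_subset_Icc_self e3.2))).ne'

end WaveOperator

end VarWave

/-! ### The nonlinear theorem. -/

open VarWave in
/-- Under the global nonresonance condition, `0` is the only weak solution in `M_o`. -/
theorem theorem4p2
    (u : ℝ → ℝ) (f : ℝ → ℝ → ℝ → ℝ) (p q : ℕ) (T : ℝ)
    -- the period `T = 2π p / q`, with `p` even
    (hp : 0 < p) (hq : 0 < q) (hpq : Nat.Coprime p q) (hpeven : Even p)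
    (hT : T = 2 * Real.pi * (p / q : ℝ))
    -- the nonlinearity is continuous on `Ω × ℝ` and `T`-periodic in time
    (hfcont : ContinuousOn (fun w : (ℝ × ℝ) × ℝ => f w.1.1 w.1.2 w.2) (domain T ×ˢ Set.univ))
    (hfper : ∀ t, ∀ x ∈ Set.Ioo 0 Real.pi, ∀ y, f (t + T) x y = f t x y)
    -- the coefficient
    (hu : ContDiffOn ℝ 2 u (Set.Icc 0 Real.pi)) (hupos : ∀ x ∈ Set.Icc 0 Real.pi, 0 < u x)
    -- local boundedness of `f / u` by square-integrable functions
    (hH2 : ∀ R : ℝ, 0 < R → ∃ h : ℝ × ℝ → ℝ, MemL2 u T h ∧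
      ∀ᵐ z ∂(dom T), ∀ y : ℝ, |y| ≤ R → |fhat u f z.1 z.2 y| ≤ h z)
    -- two consecutive eigenvalues of `L_o`
    (lam₁ lam₂ : ℝ) (hlam : Consecutive (eigenvaluesLo u T) lam₁ lam₂)
    (α β : ℝ × ℝ → ℝ)
    (hαMe : MemMe u T α) (hαbdd : MeasureTheory.MemLp α ⊤ (dom T))
    (hβMe : MemMe u T β) (hβbdd : MeasureTheory.MemLp β ⊤ (dom T))
    (hαβ : ∀ᵐ z ∂(dom T), lam₁ ≤ α z ∧ α z ≤ β z ∧ β z ≤ lam₂)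
    (hα : ∀ v, MemKerLo u T lam₁ v → ¬ v =ᵐ[dom T] 0 →
      0 < ∫ z, (α z - lam₁) * v z ^ 2 ∂(dom T))
    (hβ : ∀ w, MemKerLo u T lam₂ w → ¬ w =ᵐ[dom T] 0 →
      0 < ∫ z, (lam₂ - β z) * w z ^ 2 ∂(dom T))
    -- symmetry of `f / u`: `T/2`-periodic in `t`, odd in `y`
    (hfhalf : ∀ t, ∀ x ∈ Set.Ioo 0 Real.pi, ∀ y,
      fhat u f t x y = fhat u f (t + T / 2) x y)
    (hfodd : ∀ t, ∀ x ∈ Set.Ioo 0 Real.pi, ∀ y, fhat u f t x (-y) = - fhat u f t x y)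
    -- global nonresonance
    (hres : ∀ᵐ z ∂(dom T), ∀ y₁ y₂ : ℝ, y₁ ≠ y₂ →
      α z ≤ (fhat u f z.1 z.2 y₁ - fhat u f z.1 z.2 y₂) / (y₁ - y₂) ∧
      (fhat u f z.1 z.2 y₁ - fhat u f z.1 z.2 y₂) / (y₁ - y₂) ≤ β z) :
    (MemMo u T (fun _ => 0) ∧ IsWeakSolution u T f (fun _ => 0)) ∧
    ∀ y : ℝ × ℝ → ℝ, MemMo u T y → IsWeakSolution u T f y → y =ᵐ[dom T] 0 := by

  have hTpos : 0 < T := by rw [hT]; have := Real.pi_pos; positivity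
  have huc := hu.continuousOn
  have hfhat0 : ∀ t, ∀ x ∈ Set.Ioo 0 Real.pi, fhat u f t x 0 = 0 := by
    intro t x hx
    have := hfodd t x hx 0
    rw [neg_zero] at this
    linarith
  have hfu : ∀ z ∈ domain T, ∀ y, f z.1 z.2 y = u z.2 * fhat u f z.1 z.2 y := by
    intro z hz y
    rw [fhat, mul_div_cancel₀ _ (hupos z.2 (Set.Ioo_subset_Icc_self hz.2)).ne']
  refine ⟨⟨⟨(memL2_iff_memLp huc hupos _).2 MeasureTheory.MemLp.zero', ?_⟩,
    (memL2_iff_memLp huc hupos _).2 MeasureTheory.MemLp.zero', fun ψ hψ => ?_⟩, fun y hy hys => ?_⟩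
  · simp [HalfAntiperiodic]
  · have h0 : (fun z => f z.1 z.2 0 * ψ z) =ᵐ[dom T] fun _ => 0 := by
      filter_upwards [ae_mem_domain T] with z hz
      rw [hfu z hz, hfhat0 _ _ hz.2, mul_zero, zero_mul]
    refine ⟨(MeasureTheory.integrable_zero _ _ _).congr h0.symm, ?_⟩
    rw [MeasureTheory.integral_congr_ae h0]
    simp
  · set g : ℝ × ℝ → ℝ := fun z => fhat u f z.1 z.2 (y z) with hg
    have hym := (memL2_iff_memLp huc hupos y).1 hy.1
    have hslope : ∀ᵐ z ∂(dom T), ∃ a, α z ≤ a ∧ a ≤ β z ∧ g z = a * y z := by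
      filter_upwards [hres, ae_mem_domain T, hαβ] with z h1 h2 h3
      by_cases h0 : y z = 0
      -- Where `y = 0` also `g = 0`, so any slope in `[α, β]` will do; elsewhere it is the
      -- difference quotient between `y` and `0`.
      · exact ⟨α z, le_rfl, h3.2.1, by simp only [hg, h0, hfhat0 _ _ h2.2, mul_zero]⟩
      · have h4 := h1 (y z) 0 h0
        rw [hfhat0 _ _ h2.2, sub_zero, sub_zero] at h4
        exact ⟨_, h4.1, h4.2, (div_mul_cancel₀ _ h0).symm⟩
    have hgmeas : MeasureTheory.AEStronglyMeasurable g (dom T) := by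
      -- Measurability of `g` is extracted from the integrability clause of the weak formulation for
      -- `ψ = sin x`, which is positive on `(0, π)` and can be divided out.
      have h1 := (hys.2 _ (isTestFunction_mul_trig hTpos Real.contDiff_sin Real.sin_zero
        Real.sin_pi false 0)).1.1
      have h2 : MeasureTheory.AEStronglyMeasurable (fun z : ℝ × ℝ => (u z.2)⁻¹) (dom T) :=
        (memLp_top_comp_snd (huc.inv₀ fun x hx => (hupos x hx).ne')).1
      have h3 : MeasureTheory.AEStronglyMeasurable (fun z : ℝ × ℝ => (Real.sin z.2)⁻¹) (dom T) :=
        (Real.measurable_sin.comp measurable_snd).inv.aestronglyMeasurable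
      refine ((h1.mul h2).mul h3).congr ?_
      filter_upwards [ae_mem_domain T] with z hz
      have h4 := (hupos z.2 (Set.Ioo_subset_Icc_self hz.2)).ne'
      have h5 := (Real.sin_pos_of_pos_of_lt_pi hz.2.1 hz.2.2).ne'
      simp only [Pi.mul_apply, hg, fhat, trig, cond_false, Nat.cast_zero, mul_zero, zero_mul,
        Real.cos_zero]
      field_simp
    have hgm : MeasureTheory.MemLp g 2 (dom T) := by
      refine hym.of_le_mul (c := max |lam₁| |lam₂|) hgmeas ?_
      filter_upwards [hslope, hαβ] with z ⟨a, h1, h2, h3⟩ h4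
      rw [h3, norm_mul]
      refine mul_le_mul_of_nonneg_right ?_ (norm_nonneg _)
      exact abs_le_max_abs_abs (h4.1.trans h1) (h2.trans h4.2.2)
    refine ae_eq_zero_of_nonresonance hTpos hu hupos hlam hαβ hα hβ hy
      ((waveOp_iff huc hupos y g).2 ⟨hym, hgm, fun ν φ hφ s m => ?_⟩) hslope
    refine modeCoeff_of_weak hTpos hu (hym.integrable (by norm_num)) (hgm.integrable (by norm_num))
      (fun ψ hψ => ?_) hφ s m
    rw [← (hys.2 ψ hψ).2]
    congr 1
    refine MeasureTheory.integral_congr_ae ?_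
    filter_upwards [ae_mem_domain T] with z hz
    rw [hfu z hz]
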